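/- Let $M$ be a finite-dimensional paracompact (Hausdorff) smooth manifold and $\mathcal E\to M$ a complex vector bundle with fibre $\mathbb C^n$, $n\ge 1$, associated with a principal $SU(n)$-bundle. Let $A=\Gamma(\mathrm{End}\,\mathcal E)$, so that $Z(A)=C^\infty(M)$ (complex-valued functions); let $A_0\subset A$ be the traceless elements, $\mathrm{Der}(A)$ the $Z(A)$-module of derivations of $A$, $\Gamma(TM)=\mathrm{Der}(C^\infty(M))$ the (complex) vector fields, $\rho:\mathrm{Der}(A)\to\Gamma(TM)$ the restriction of derivations to $Z(A)$, and $\mathrm{ad}:A_0\to\mathrm{Der}(A)$, $\mathrm{ad}_\gamma(a)=[\gamma,a]$. For a $Z(A)$-module $N$ put $\Omega_N=\mathrm{Hom}_{Z(A)}(N,A)$, an $A$-bimodule; thus $\Omega^1_{\mathrm{Der}}(A)=\Omega_{\mathrm{Der}(A)}$ are the noncommutative 1-forms, $\Omega^1(M,\mathrm{End}\,\mathcal E)=\Omega_{\Gamma(TM)}$ the tensorial forms and $\Omega_{\mathrm{Int}}(A)=\Omega_{A_0}$ the interior forms. A homomorphism of bimodules $h:\Omega_N\otimes_A\Omega_N\to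 A$ is *symmetric* if $h(\omega,\eta)=h(\eta,\omega)$ for all $Z(A)$-valued $\omega,\eta$; it is *nondegenerate* if $\omega\mapsto[\eta\mapsto h(\omega,\eta)]$ is an isomorphism of $\Omega_N$ onto the left $A$-module generated by the evaluations $\eta\mapsto\eta(X)$, $X\in N$; it is a *metric* if it is both. (The same notions are used with $A$ replaced by $C^\infty(M)$.) For a $Z(A)$-linear map $\varphi:N\to N'$ put $(\varphi_*h)(\mu,\nu)=h(\mu\circ\varphi,\nu\circ\varphi)$. Connections on $\mathcal E$ are taken with structure group $SL(n,\mathbb C)$, i.e. they preserve the volume form which the $SU(n)$-structure gives on the fibres (their local connection forms are traceless). Such a connection induces a connection on $\mathrm{End}\,\mathcal E$, i.e. a $C^\infty(M)$-linear map $X\mapsto\nabla_X\in\mathrm{Der}(A)$, and a noncommutative 1-form $\alpha:\mathrm{Der}(A)\to A_0$ defined by $\mathcal X=\nabla_{\rho(\mathcal X)}-\mathrm{ad}_{\alpha(\mathcal X)}$. **Proposition.** Let $h$ be a metric on $\Omega^1_{\mathrm{Der}}(A)$ such that its restriction $\rho_*h:\Omega^1(M)\otimes_{C^\infty(M)}\Omega^1(M)\to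 C^\infty(M)$, $(\mu,\nu)\mapsto h(\mu\circ\rho,\nu\circ\rho)$, is nondegenerate. Then there is a unique connection $\nabla$ on $\mathcal E$ such that $$h(\mu\circ\rho,\ \eta\circ\alpha)=0\qquad\text{for all }\mu\in\Omega^1(M,\mathrm{End}\,\mathcal E),\ \eta\in\Omega_{\mathrm{Int}}(A).$$ For this connection, $h^M=\rho_*h$ is a metric on the tensorial forms, $h_{\mathrm{Int}}=\alpha_*h$ is a metric on $\Omega_{\mathrm{Int}}(A)$, and $$h=\nabla_*h^M+\mathrm{ad}_*h_{\mathrm{Int}}.$$ If moreover $h$ is real, i.e. $h(\omega,\eta)$ is Hermitian whenever $\omega,\eta$ are $Z(A)$-valued forms whose values on real derivations (those with $\mathcal X(a^*)=\mathcal X(a)^*$) are Hermitian, then $\nabla$ is an $SU(n)$-connection. -/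

import Mathlib

namespace NCG

noncomputable section

/-! ### Bimodule-valued forms and bimodule metrics -/

section Forms

variable (Z B : Type*) [CommRing Z] [Ring B] [Algebra Z B]

/-- `B`-valued one-forms on a `Z`-module `N`: the bimodule `Hom_Z(N, B)`. -/
abbrev Forms (N : Type*) [AddCommGroup N] [Module Z N] := N →ₗ[Z] B

variable {Z B} {N N' : Type*} [AddCommGroup N] [Module Z N] [AddCommGroup N'] [Module Z N']

/-- The left action `(b ω)(X) = b ω(X)`. -/
def lmul (b : B) (ω : Forms Z B N) : Forms Z B N := (LinearMap.mulLeft Z b).comp ω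

/-- The right action `(ω b)(X) = ω(X) b`. -/
def rmul (ω : Forms Z B N) (b : B) : Forms Z B N := (LinearMap.mulRight Z b).comp ω

/-- The pull-back `φ^* ω = ω ∘ φ` of a form along a `Z`-linear map. -/
def pullback (φ : N →ₗ[Z] N') (ω : Forms Z B N') : Forms Z B N := ω.comp φ

variable (Z B N) in
/-- Homomorphisms of bimodules `h : Ω ⊗_B Ω → B`, where `Ω = Hom_Z(N, B)`,
written as balanced biadditive maps. -/
@[ext]
structure BimoduleForm where
  toFun : Forms Z B N → Forms Z B N → B
  add_left : ∀ ω ω' η, toFun (ω + ω') η = toFun ω η + toFun ω' η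
  add_right : ∀ ω η η', toFun ω (η + η') = toFun ω η + toFun ω η'
  lmul_left : ∀ b ω η, toFun (lmul b ω) η = b * toFun ω η
  rmul_right : ∀ ω η b, toFun ω (rmul η b) = toFun ω η * b
  balanced : ∀ ω b η, toFun (rmul ω b) η = toFun ω (lmul b η)

/-- A form with values in the centre of `B`. -/
def IsCentralForm (ω : Forms Z B N) : Prop := ∀ X, ω X ∈ Subring.center B

namespace BimoduleForm

/-- Symmetry: `h(ω, η) = h(η, ω)` for all forms with central values. -/
def IsSymmetric (h : BimoduleForm Z B N) : Prop :=
  ∀ ω η, IsCentralForm ω → IsCentralForm η → h.toFun ω η = h.toFun η ω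

/-- Nondegeneracy: `h^♯ : ω ↦ [η ↦ h(ω, η)]` is an isomorphism of `Hom_Z(N, B)` onto the left
`B`-module `B-N` generated by the evaluations `η ↦ η(X)`, `X ∈ N`, inside the module of
maps from `Hom_Z(N, B)` to `B`. -/
def IsNondegenerate (h : BimoduleForm Z B N) : Prop :=
  Function.Injective h.toFun ∧
    Set.range h.toFun =
      (Submodule.span B (Set.range fun (X : N) (η : Forms Z B N) => η X) :
        Set (Forms Z B N → B))

/-- A metric is a symmetric nondegenerate homomorphism of bimodules `Ω ⊗_B Ω → B`. -/
def IsMetric (h : BimoduleForm Z B N) : Prop := h.IsSymmetric ∧ h.IsNondegenerate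

/-- The push-forward `(φ_* h)(μ, ν) = h(μ ∘ φ, ν ∘ φ)`. -/
def push (φ : N →ₗ[Z] N') (h : BimoduleForm Z B N) : BimoduleForm Z B N' where
  toFun μ ν := h.toFun (pullback φ μ) (pullback φ ν)
  add_left μ μ' ν := h.add_left (pullback φ μ) (pullback φ μ') (pullback φ ν)
  add_right μ ν ν' := h.add_right (pullback φ μ) (pullback φ ν) (pullback φ ν')
  lmul_left b μ ν := h.lmul_left b (pullback φ μ) (pullback φ ν)
  rmul_right μ ν b := h.rmul_right (pullback φ μ) (pullback φ ν) b
  balanced μ b ν := h.balanced (pullback φ μ) b (pullback φ ν)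

end BimoduleForm

end Forms

/-! ### Derivations of an algebra -/

section Derivations

variable (A : Type*) [Ring A] [Algebra ℂ A]

/-- The centre `Z(A)`. -/
abbrev Ctr := Subalgebra.center ℂ A

instance : Algebra (Ctr A) A where
  algebraMap := (Ctr A).val.toRingHom
  commutes' z a := (Subalgebra.mem_center_iff.mp z.2 a).symm
  smul_def' _ _ := rfl

/-- The `Z(A)`-module `Der(A)` of `ℂ`-linear derivations of `A`. -/
def Der : Submodule (Ctr A) (A →ₗ[ℂ] A) where
  carrier := {D | ∀ a b, D (a * b) = a * D b + D a * b}
  zero_mem' := by intro a b; simp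
  add_mem' := by
    intro D D' hD hD' a b
    simp only [LinearMap.add_apply, hD a b, hD' a b, mul_add, add_mul]
    abel
  smul_mem' := by
    intro z D hD a b
    have hz : a * (z : A) = z * a := (Subalgebra.mem_center_iff.mp z.2 a)
    simp only [LinearMap.smul_apply, hD a b, Subalgebra.smul_def, smul_eq_mul, mul_add]
    rw [← mul_assoc, ← hz]
    simp only [mul_assoc]

/-- Derivations of the centre. When `A` is the algebra of sections of `End 𝓔` over a manifold `M`,
`Z(A) = C^∞(M)` and these are the (complex) vector fields on `M`. -/
abbrev VF := Derivation ℂ (Ctr A) (Ctr A)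

variable {A}

theorem Der.map_center (X : Der A) (z : Ctr A) : X.1 (z : A) ∈ Subalgebra.center ℂ A := by
  rw [Subalgebra.mem_center_iff]
  intro b
  have hz : b * (z : A) = z * b := (Subalgebra.mem_center_iff.mp z.2 b)
  have hz' : X.1 b * (z : A) = z * X.1 b := (Subalgebra.mem_center_iff.mp z.2 (X.1 b))
  have h := congrArg X.1 hz
  rw [X.2 b z, X.2 z b, hz', add_comm] at h
  exact add_left_cancel h

/-- The restriction `ρ : Der(A) → Der(Z(A))` of derivations to the centre. -/
def rho : Der A →ₗ[Ctr A] VF A where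
  toFun X := Derivation.mk'
    { toFun := fun z => ⟨X.1 (z : A), Der.map_center X z⟩
      map_add' := fun z w => Subtype.ext (by simp)
      map_smul' := fun c z => Subtype.ext (by simp) }
    (by
      intro z w
      apply Subtype.ext
      have hw : X.1 (z : A) * (w : A) = w * X.1 (z : A) :=
        Subalgebra.mem_center_iff.mp w.2 (X.1 z)
      simpa [hw] using X.2 (z : A) (w : A))
  map_add' X Y := by ext z; simp
  map_smul' c X := by ext z; simp [Subalgebra.smul_def]

/-- The inner derivation `ad_γ (a) = γ a - a γ`. -/
def ad : A →ₗ[Ctr A] Der A where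
  toFun γ := ⟨LinearMap.mulLeft ℂ γ - LinearMap.mulRight ℂ γ, by
    intro a b
    simp only [LinearMap.sub_apply, LinearMap.mulLeft_apply, LinearMap.mulRight_apply]
    noncomm_ring⟩
  map_add' γ δ := by
    apply Subtype.ext; ext a; simp [add_mul, mul_add]; abel
  map_smul' z γ := by
    apply Subtype.ext; ext a
    have hz : a * (z : A) = z * a := (Subalgebra.mem_center_iff.mp z.2 a)
    simp [Subalgebra.smul_def, mul_sub, mul_assoc]
    rw [← mul_assoc, hz, mul_assoc]

variable {N : Type*} [AddCommGroup N] [Module (Ctr A) N]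

/-- The inclusion of `Z(A)`-valued forms into `A`-valued forms. -/
def centralForm (μ : Forms (Ctr A) (Ctr A) N) : Forms (Ctr A) A N :=
  (Algebra.linearMap (Ctr A) A).comp μ

theorem rmul_centralForm (μ : Forms (Ctr A) (Ctr A) N) (b : A) :
    rmul (centralForm μ) b = lmul b (centralForm μ) := by
  ext X
  exact (Subalgebra.mem_center_iff.mp (μ X).2 b).symm

theorem BimoduleForm.central_mem (h : BimoduleForm (Ctr A) A N)
    (μ ν : Forms (Ctr A) (Ctr A) N) :
    h.toFun (centralForm μ) (centralForm ν) ∈ Subalgebra.center ℂ A := by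
  rw [Subalgebra.mem_center_iff]
  intro b
  rw [← h.lmul_left, ← rmul_centralForm, h.balanced, ← rmul_centralForm, h.rmul_right]

/-- The restriction of `h` to `Z(A)`-valued forms, which takes its values in `Z(A)`. -/
def BimoduleForm.restrictCenter (h : BimoduleForm (Ctr A) A N) :
    BimoduleForm (Ctr A) (Ctr A) N where
  toFun μ ν := ⟨h.toFun (centralForm μ) (centralForm ν), h.central_mem μ ν⟩
  add_left μ μ' ν := by
    apply Subtype.ext
    have : centralForm (μ + μ') = centralForm μ + centralForm μ' := by ext X; simp [centralForm]
    simp [this, h.add_left]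
  add_right μ ν ν' := by
    apply Subtype.ext
    have : centralForm (ν + ν') = centralForm ν + centralForm ν' := by ext X; simp [centralForm]
    simp [this, h.add_right]
  lmul_left z μ ν := by
    apply Subtype.ext
    exact h.lmul_left (z : A) (centralForm μ) (centralForm ν)
  rmul_right μ ν z := by
    apply Subtype.ext
    exact h.rmul_right (centralForm μ) (centralForm ν) (z : A)
  balanced μ z ν := by
    apply Subtype.ext
    exact h.balanced (centralForm μ) (z : A) (centralForm ν)

end Derivations

end

end NCG

open scoped Manifold ContDiff
open Bundle

namespace NCG

noncomputable section

/-! ### Vector bundles with structure group `SU(n)` -/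

section BundleDefs

/-- The typical fibre `ℂⁿ`. -/
abbrev Fib (n : ℕ) := EuclideanSpace ℂ (Fin n)

/-- `𝓔` is a smooth vector bundle with fibre `ℂⁿ` associated with a principal `SU(n)`-bundle:
the coordinate changes of its atlas are smooth functions with values in `SU(n)`. -/
class IsSUBundle (d n : ℕ) {M : Type*} [TopologicalSpace M]
    [ChartedSpace (EuclideanSpace ℝ (Fin d)) M]
    (E : M → Type*) [∀ x, AddCommGroup (E x)] [∀ x, Module ℂ (E x)] [∀ x, TopologicalSpace (E x)]
    [TopologicalSpace (TotalSpace (Fib n) E)] [FiberBundle (Fib n) E]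
    [VectorBundle ℂ (Fib n) E] : Prop where
  smooth : ∀ (e e' : Trivialization (Fib n) (π (Fib n) E)) [MemTrivializationAtlas e]
    [MemTrivializationAtlas e'] (v : Fib n),
    ContMDiffOn (𝓡 d) 𝓘(ℝ, Fib n) ∞ (fun x => e.coordChangeL ℂ e' x v) (e.baseSet ∩ e'.baseSet)
  isometry : ∀ (e e' : Trivialization (Fib n) (π (Fib n) E)) [MemTrivializationAtlas e]
    [MemTrivializationAtlas e'], ∀ x ∈ e.baseSet ∩ e'.baseSet, ∀ v w : Fib n,
    inner ℂ (e.coordChangeL ℂ e' x v) (e.coordChangeL ℂ e' x w) = inner ℂ v w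
  det_eq_one : ∀ (e e' : Trivialization (Fib n) (π (Fib n) E)) [MemTrivializationAtlas e]
    [MemTrivializationAtlas e'], ∀ x ∈ e.baseSet ∩ e'.baseSet,
    LinearMap.det (e.coordChangeL ℂ e' x : Fib n →ₗ[ℂ] Fib n) = 1

theorem contMDiffOn_smulC {d n : ℕ} {M : Type*} [TopologicalSpace M]
    [ChartedSpace (EuclideanSpace ℝ (Fin d)) M] {f : M → ℂ} {g : M → Fib n} {U : Set M}
    (hf : ContMDiffOn (𝓡 d) 𝓘(ℝ, ℂ) ∞ f U) (hg : ContMDiffOn (𝓡 d) 𝓘(ℝ, Fib n) ∞ g U) :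
    ContMDiffOn (𝓡 d) 𝓘(ℝ, Fib n) ∞ (fun x => f x • g x) U := by
  have hsm : ContMDiff 𝓘(ℝ, ℂ × Fib n) 𝓘(ℝ, Fib n) ∞ (fun p : ℂ × Fib n => p.1 • p.2) :=
    ContDiff.contMDiff (contDiff_fst.smul contDiff_snd)
  exact hsm.comp_contMDiffOn (hf.prodMk_space hg)

variable (d n : ℕ) {M : Type*} [TopologicalSpace M] [ChartedSpace (EuclideanSpace ℝ (Fin d)) M]
  (E : M → Type*) [∀ x, AddCommGroup (E x)] [∀ x, Module ℂ (E x)] [∀ x, TopologicalSpace (E x)]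
  [TopologicalSpace (TotalSpace (Fib n) E)] [FiberBundle (Fib n) E] [VectorBundle ℂ (Fib n) E]

/-- The space `Γ(𝓔)` of smooth sections of `𝓔`. -/
def Sec : Submodule ℂ (∀ x, E x) where
  carrier := {s | ∀ (e : Trivialization (Fib n) (π (Fib n) E)) [MemTrivializationAtlas e],
    ContMDiffOn (𝓡 d) 𝓘(ℝ, Fib n) ∞ (fun x => e.linearMapAt ℂ x (s x)) e.baseSet}
  zero_mem' := by
    intro e _
    simpa using contMDiffOn_const
  add_mem' := by
    intro s t hs ht e _
    refine ((hs e).add (ht e)).congr fun x _ => ?_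
    simp
  smul_mem' := by
    intro c s hs e _
    have hc : ContMDiff 𝓘(ℝ, Fib n) 𝓘(ℝ, Fib n) ∞ (fun v : Fib n => c • v) :=
      ((c • ContinuousLinearMap.id ℝ (Fib n)).contDiff).contMDiff
    refine (hc.comp_contMDiffOn (hs e)).congr fun x _ => ?_
    simp

/-- A family of fibre endomorphisms `a` is smooth when its matrix is smooth in every local
trivialization of the atlas. -/
def IsSmoothEnd (a : ∀ x, Module.End ℂ (E x)) : Prop :=
  ∀ (e : Trivialization (Fib n) (π (Fib n) E)) [MemTrivializationAtlas e] (v : Fib n),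
    ContMDiffOn (𝓡 d) 𝓘(ℝ, Fib n) ∞ (fun x => e.linearMapAt ℂ x (a x (e.symm x v))) e.baseSet

variable {d n E}

theorem IsSmoothEnd.apply {a : ∀ x, Module.End ℂ (E x)} (ha : IsSmoothEnd d n E a)
    {s : ∀ x, E x} (e : Trivialization (Fib n) (π (Fib n) E)) [MemTrivializationAtlas e]
    (hs : ContMDiffOn (𝓡 d) 𝓘(ℝ, Fib n) ∞ (fun x => e.linearMapAt ℂ x (s x)) e.baseSet) :
    ContMDiffOn (𝓡 d) 𝓘(ℝ, Fib n) ∞ (fun x => e.linearMapAt ℂ x (a x (s x))) e.baseSet := by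
  have key : ∀ x ∈ e.baseSet, e.linearMapAt ℂ x (a x (s x)) =
      ∑ i, (e.linearMapAt ℂ x (s x)) i •
        e.linearMapAt ℂ x (a x (e.symm x (EuclideanSpace.single i 1))) := by
    intro x hx
    conv_lhs => rw [← e.symmₗ_linearMapAt (R := ℂ) hx (s x)]
    conv_lhs =>
      rw [← (EuclideanSpace.basisFun (Fin n) ℂ).sum_repr (e.linearMapAt ℂ x (s x))]
    rw [map_sum, map_sum, map_sum]
    simp only [map_smul, EuclideanSpace.basisFun_apply, EuclideanSpace.basisFun_repr]
    simp only [e.symmₗ_apply hx]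
  refine ContMDiffOn.congr ?_ key
  refine contMDiffOn_finsetSum ?_
  intro i _
  have hi : ContMDiffOn (𝓡 d) 𝓘(ℝ, ℂ) ∞ (fun x => (e.linearMapAt ℂ x (s x)) i) e.baseSet := by
    have hp : ContMDiff 𝓘(ℝ, Fib n) 𝓘(ℝ, ℂ) ∞ (fun v : Fib n => v i) :=
      ((EuclideanSpace.proj (𝕜 := ℂ) i : Fib n →L[ℂ] ℂ).restrictScalars ℝ).contDiff.contMDiff
    exact hp.comp_contMDiffOn hs
  exact contMDiffOn_smulC hi (ha e _)

variable (d n E) in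
/-- The algebra `A = Γ(End 𝓔)` of smooth sections of the endomorphism bundle. -/
def EndAlg : Subalgebra ℂ (∀ x, Module.End ℂ (E x)) where
  carrier := {a | IsSmoothEnd d n E a}
  mul_mem' := by
    intro a b ha hb e _ v
    exact ha.apply (s := fun x => b x (e.symm x v)) e (hb e v)
  add_mem' := by
    intro a b ha hb e _ v
    refine ((ha e v).add (hb e v)).congr fun x _ => ?_
    simp
  algebraMap_mem' := by
    intro c e _ v
    refine (contMDiffOn_const (c := c • v)).congr ?_
    intro x hx
    simp [Module.algebraMap_end_apply, e.linearMapAt_symm hx]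

variable (d n E) in
/-- The algebra `A = Γ(End 𝓔)`, as a type. -/
def EndSec : Type _ := EndAlg d n E

instance : Ring (EndSec d n E) := inferInstanceAs (Ring (EndAlg d n E))

instance : Algebra ℂ (EndSec d n E) := inferInstanceAs (Algebra ℂ (EndAlg d n E))

/-- The value at `x` of a section of `End 𝓔`. -/
def EndSec.val (a : EndSec d n E) (x : M) : Module.End ℂ (E x) := Subtype.val (p := _) a x

/-- The section of `End 𝓔` with given values. -/
def EndSec.mk (a : ∀ x, Module.End ℂ (E x)) (ha : IsSmoothEnd d n E a) : EndSec d n E := ⟨a, ha⟩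

namespace EndSec

theorem smooth (a : EndSec d n E) : IsSmoothEnd d n E a.val := Subtype.prop (p := _) a

@[ext]
theorem ext {a b : EndSec d n E} (h : ∀ x, a.val x = b.val x) : a = b := Subtype.ext (funext h)

@[simp] theorem val_mk (a : ∀ x, Module.End ℂ (E x)) (ha : IsSmoothEnd d n E a) (x : M) :
    (EndSec.mk a ha).val x = a x := rfl

@[simp] theorem val_zero (x : M) : (0 : EndSec d n E).val x = 0 := rfl

@[simp] theorem val_add (a b : EndSec d n E) (x : M) : (a + b).val x = a.val x + b.val x := rfl

@[simp] theorem val_mul (a b : EndSec d n E) (x : M) : (a * b).val x = a.val x * b.val x := rfl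

end EndSec

/-- The action of `Γ(End 𝓔)` on `Γ(𝓔)`. -/
def act (a : EndSec d n E) (s : Sec d n E) : Sec d n E :=
  ⟨fun x => a.val x (s.1 x), fun e _ => IsSmoothEnd.apply a.smooth e (s.2 e)⟩

variable (E) in
/-- The central element `f · 1` of `Γ(End 𝓔)` defined by a smooth function `f : M → ℂ`. -/
def scalar (f : M → ℂ) (hf : ContMDiff (𝓡 d) 𝓘(ℝ, ℂ) ∞ f) : Ctr (EndSec d n E) :=
  ⟨EndSec.mk (fun x => f x • LinearMap.id) (by
    intro e _ v
    refine (contMDiffOn_smulC hf.contMDiffOn (contMDiffOn_const (c := v))).congr ?_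
    intro x hx
    simp [e.linearMapAt_symm hx]), by
    rw [Subalgebra.mem_center_iff]
    intro b
    refine EndSec.ext fun x => LinearMap.ext fun v => ?_
    exact (map_smul (b.val x) (f x) v)⟩

theorem contMDiffOn_coordChange [IsSUBundle d n E]
    (e e' : Trivialization (Fib n) (π (Fib n) E)) [MemTrivializationAtlas e]
    [MemTrivializationAtlas e'] {g : M → Fib n} {U : Set M} (hU : U ⊆ e.baseSet ∩ e'.baseSet)
    (hg : ContMDiffOn (𝓡 d) 𝓘(ℝ, Fib n) ∞ g U) :
    ContMDiffOn (𝓡 d) 𝓘(ℝ, Fib n) ∞ (fun x => e.coordChangeL ℂ e' x (g x)) U := by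
  have key : ∀ x ∈ U, e.coordChangeL ℂ e' x (g x) =
      ∑ i, (g x) i • e.coordChangeL ℂ e' x (EuclideanSpace.single i 1) := by
    intro x _
    conv_lhs => rw [← (EuclideanSpace.basisFun (Fin n) ℂ).sum_repr (g x)]
    rw [map_sum]
    simp only [map_smul, EuclideanSpace.basisFun_apply, EuclideanSpace.basisFun_repr]
  refine ContMDiffOn.congr ?_ key
  refine contMDiffOn_finsetSum ?_
  intro i _
  have hi : ContMDiffOn (𝓡 d) 𝓘(ℝ, ℂ) ∞ (fun x => (g x) i) U := by
    have hp : ContMDiff 𝓘(ℝ, Fib n) 𝓘(ℝ, ℂ) ∞ (fun v : Fib n => v i) :=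
      ((EuclideanSpace.proj (𝕜 := ℂ) i : Fib n →L[ℂ] ℂ).restrictScalars ℝ).contDiff.contMDiff
    exact hp.comp_contMDiffOn hg
  exact contMDiffOn_smulC hi ((IsSUBundle.smooth e e' _).mono hU)

theorem exists_end_eq [IsManifold (𝓡 d) ∞ M] [T2Space M] [IsSUBundle d n E] (x₀ : M)
    (T : Module.End ℂ (E x₀)) : ∃ a : EndSec d n E, a.val x₀ = T := by
  classical
  set e := trivializationAt (Fib n) E x₀ with he
  have hx₀ : x₀ ∈ e.baseSet := mem_baseSet_trivializationAt (Fib n) E x₀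
  obtain ⟨f, -, hf⟩ := (SmoothBumpFunction.nhds_basis_tsupport (I := 𝓡 d) x₀).mem_iff.mp
    (e.open_baseSet.mem_nhds hx₀)
  let T₀ : Fib n →ₗ[ℂ] Fib n := (e.linearMapAt ℂ x₀).comp (T.comp (e.symmₗ ℂ x₀))
  let a : ∀ x, Module.End ℂ (E x) := fun x =>
    ((f x : ℝ) : ℂ) • (e.symmₗ ℂ x).comp (T₀.comp (e.linearMapAt ℂ x))
  refine ⟨EndSec.mk a ?_, ?_⟩
  · intro e' _ v y hy
    by_cases hyf : y ∈ tsupport f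
    · have hye : y ∈ e.baseSet := hf hyf
      have hV : e.baseSet ∩ e'.baseSet ∈ nhds y :=
        (e.open_baseSet.inter e'.open_baseSet).mem_nhds ⟨hye, hy⟩
      have hfs : ContMDiffOn (𝓡 d) 𝓘(ℝ, ℂ) ∞ (fun x => ((f x : ℝ) : ℂ))
          (e.baseSet ∩ e'.baseSet) :=
        (Complex.ofRealCLM.contDiff.contMDiff.comp f.contMDiff).contMDiffOn
      have h1 : ContMDiffOn (𝓡 d) 𝓘(ℝ, Fib n) ∞ (fun x => e'.coordChangeL ℂ e x v)
          (e.baseSet ∩ e'.baseSet) :=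
        (IsSUBundle.smooth e' e v).mono (fun x hx => ⟨hx.2, hx.1⟩)
      have h2 : ContMDiffOn (𝓡 d) 𝓘(ℝ, Fib n) ∞ (fun x => T₀ (e'.coordChangeL ℂ e x v))
          (e.baseSet ∩ e'.baseSet) :=
        ((LinearMap.toContinuousLinearMap T₀).restrictScalars ℝ).contDiff.contMDiff.comp_contMDiffOn
          h1
      have h3 := contMDiffOn_smulC hfs (contMDiffOn_coordChange e e' subset_rfl h2)
      have h4 : ContMDiffOn (𝓡 d) 𝓘(ℝ, Fib n) ∞
          (fun x => e'.linearMapAt ℂ x (a x (e'.symm x v))) (e.baseSet ∩ e'.baseSet) := by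
        refine h3.congr ?_
        intro x hx
        simp only [a, LinearMap.smul_apply, map_smul, LinearMap.comp_apply]
        rw [e.coordChangeL_apply e' hx, e'.coordChangeL_apply e ⟨hx.2, hx.1⟩,
          e.symmₗ_apply hx.1, e.coe_linearMapAt_of_mem hx.1, e'.coe_linearMapAt_of_mem hx.2]
      exact (h4.contMDiffAt hV).contMDiffWithinAt
    · have hV : (tsupport f)ᶜ ∈ nhds y := (isClosed_tsupport f).isOpen_compl.mem_nhds hyf
      have h0 : (fun x => e'.linearMapAt ℂ x (a x (e'.symm x v))) =ᶠ[nhds y] fun _ => 0 := by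
        filter_upwards [hV] with x hx
        have : f x = 0 := image_eq_zero_of_notMem_tsupport hx
        simp [a, this]
      exact (contMDiffAt_const.congr_of_eventuallyEq h0).contMDiffWithinAt
  · apply LinearMap.ext
    intro v
    simp [a, T₀, e.symmₗ_linearMapAt hx₀, -LinearMap.coe_comp, LinearMap.comp_apply]

/-- The centre of `Γ(End 𝓔)` consists of scalar endomorphisms. -/
theorem center_scalar [IsManifold (𝓡 d) ∞ M] [T2Space M] [IsSUBundle d n E]
    (z : Ctr (EndSec d n E)) (x : M) : ∃ c : ℂ, z.1.val x = c • LinearMap.id := by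
  have hz : ∀ T : Module.End ℂ (E x), Commute (z.1.val x) T := by
    intro T
    obtain ⟨a, rfl⟩ := exists_end_eq (d := d) (n := n) x T
    exact congrArg (fun b : EndSec d n E => b.val x) (Subalgebra.mem_center_iff.mp z.2 a).symm
  by_cases h0 : ∀ v : E x, v = 0
  · exact ⟨0, LinearMap.ext fun v => by rw [h0 v, map_zero, map_zero]⟩
  · push Not at h0
    obtain ⟨v, hv⟩ := h0
    obtain ⟨φ, hφ⟩ : ∃ φ : Module.Dual ℂ (E x), φ v ≠ 0 := by
      by_contra! h
      exact hv ((Module.forall_dual_apply_eq_zero_iff ℂ v).mp h)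
    refine ⟨φ (z.1.val x v) / φ v, LinearMap.ext fun w => ?_⟩
    have h := LinearMap.congr_fun (hz (φ.smulRight w)) v
    simp only [Module.End.mul_apply, LinearMap.smulRight_apply, map_smul] at h
    rw [LinearMap.smul_apply, LinearMap.id_apply, div_eq_inv_mul, mul_smul, ← h, smul_smul,
      inv_mul_cancel₀ hφ, one_smul]

variable (d n E) in
/-- The `Z(A)`-submodule `A₀` of traceless elements of `A = Γ(End 𝓔)`. -/
def Traceless [IsManifold (𝓡 d) ∞ M] [T2Space M] [IsSUBundle d n E] :
    Submodule (Ctr (EndSec d n E)) (EndSec d n E) where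
  carrier := {a | ∀ x, LinearMap.trace ℂ (E x) (a.val x) = 0}
  zero_mem' := by intro x; simp
  add_mem' := by
    intro a b ha hb x
    rw [EndSec.val_add, map_add, ha x, hb x, add_zero]
  smul_mem' := by
    intro z a ha x
    obtain ⟨c, hc⟩ := center_scalar z x
    have h : (z • a).val x = c • a.val x := by
      change z.1.val x * a.val x = c • a.val x
      rw [hc]
      ext v
      simp
    rw [h, map_smul, ha x, smul_zero]

variable (d n E) in
/-- The inclusion of inner derivations, `ad : A₀ → Der(A)`. -/
def adTraceless [IsManifold (𝓡 d) ∞ M] [T2Space M] [IsSUBundle d n E] :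
    Traceless d n E →ₗ[Ctr (EndSec d n E)] Der (EndSec d n E) :=
  ad.comp (Traceless d n E).subtype

/-! ### The Hermitian structure and the volume form of the fibres -/

/-- The Hermitian product of two sections, computed in any local trivialization of the atlas. -/
def hermFun (s t : Sec d n E) (x : M) : ℂ :=
  inner ℂ ((trivializationAt (Fib n) E x).linearMapAt ℂ x (s.1 x))
    ((trivializationAt (Fib n) E x).linearMapAt ℂ x (t.1 x))

/-- The determinant of `n` sections, computed in any local trivialization of the atlas. -/
def volFun (s : Fin n → Sec d n E) (x : M) : ℂ :=
  Matrix.det (Matrix.of fun i j =>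
    (trivializationAt (Fib n) E x).linearMapAt ℂ x ((s j).1 x) i)

theorem linearMapAt_eq_coordChange (e e' : Trivialization (Fib n) (π (Fib n) E))
    [MemTrivializationAtlas e] [MemTrivializationAtlas e'] {x : M}
    (hx : x ∈ e.baseSet ∩ e'.baseSet) (v : E x) :
    e'.linearMapAt ℂ x v = e.coordChangeL ℂ e' x (e.linearMapAt ℂ x v) := by
  rw [e.coordChangeL_apply e' hx, e.symm_linearMapAt hx.1, e'.coe_linearMapAt_of_mem hx.2]

theorem hermFun_eq [IsSUBundle d n E] (s t : Sec d n E)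
    (e : Trivialization (Fib n) (π (Fib n) E)) [MemTrivializationAtlas e] {x : M}
    (hx : x ∈ e.baseSet) :
    hermFun s t x = inner ℂ (e.linearMapAt ℂ x (s.1 x)) (e.linearMapAt ℂ x (t.1 x)) := by
  have hx' : x ∈ e.baseSet ∩ (trivializationAt (Fib n) E x).baseSet :=
    ⟨hx, mem_baseSet_trivializationAt (Fib n) E x⟩
  rw [hermFun, linearMapAt_eq_coordChange e _ hx', linearMapAt_eq_coordChange e _ hx',
    IsSUBundle.isometry (d := d) e _ x hx']

theorem volFun_eq [IsSUBundle d n E] (s : Fin n → Sec d n E)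
    (e : Trivialization (Fib n) (π (Fib n) E)) [MemTrivializationAtlas e] {x : M}
    (hx : x ∈ e.baseSet) :
    volFun s x = Matrix.det (Matrix.of fun i j => e.linearMapAt ℂ x ((s j).1 x) i) := by
  have hx' : x ∈ e.baseSet ∩ (trivializationAt (Fib n) E x).baseSet :=
    ⟨hx, mem_baseSet_trivializationAt (Fib n) E x⟩
  have hd := IsSUBundle.det_eq_one (d := d) e (trivializationAt (Fib n) E x) x hx'
  set c : Fib n →ₗ[ℂ] Fib n := (e.coordChangeL ℂ (trivializationAt (Fib n) E x) x :
    Fib n →ₗ[ℂ] Fib n) with hc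
  have hb := (EuclideanSpace.basisFun (Fin n) ℂ).toBasis.det_comp c
    (fun j => e.linearMapAt ℂ x ((s j).1 x))
  rw [hd, one_mul, Module.Basis.det_apply, Module.Basis.det_apply] at hb
  have h1 : (Matrix.of fun i j =>
      (trivializationAt (Fib n) E x).linearMapAt ℂ x ((s j).1 x) i) =
      (EuclideanSpace.basisFun (Fin n) ℂ).toBasis.toMatrix
        (c ∘ fun j => e.linearMapAt ℂ x ((s j).1 x)) := by
    refine Matrix.ext fun i j => ?_
    simp [Module.Basis.toMatrix_apply, hc, linearMapAt_eq_coordChange e _ hx']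
  have h2 : (Matrix.of fun i j => e.linearMapAt ℂ x ((s j).1 x) i) =
      (EuclideanSpace.basisFun (Fin n) ℂ).toBasis.toMatrix
        (fun j => e.linearMapAt ℂ x ((s j).1 x)) := by
    refine Matrix.ext fun i j => ?_
    simp [Module.Basis.toMatrix_apply]
  rw [volFun, h1, h2, hb]

theorem contMDiff_hermFun [IsSUBundle d n E] (s t : Sec d n E) :
    ContMDiff (𝓡 d) 𝓘(ℝ, ℂ) ∞ (hermFun s t) := by
  intro y
  set e := trivializationAt (Fib n) E y
  have hy : y ∈ e.baseSet := mem_baseSet_trivializationAt (Fib n) E y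
  have h : ContMDiffOn (𝓡 d) 𝓘(ℝ, ℂ) ∞ (hermFun s t) e.baseSet := by
    have hin : ContMDiff 𝓘(ℝ, Fib n × Fib n) 𝓘(ℝ, ℂ) ∞
        (fun p : Fib n × Fib n => inner ℂ p.1 p.2) :=
      ContDiff.contMDiff ((contDiff_inner (𝕜 := ℂ) (E := Fib n)))
    exact (hin.comp_contMDiffOn ((s.2 e).prodMk_space (t.2 e))).congr
      fun x hx => hermFun_eq s t e hx
  exact h.contMDiffAt (e.open_baseSet.mem_nhds hy)

theorem contMDiff_volFun [IsSUBundle d n E] (s : Fin n → Sec d n E) :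
    ContMDiff (𝓡 d) 𝓘(ℝ, ℂ) ∞ (volFun s) := by
  intro y
  set e := trivializationAt (Fib n) E y
  have hy : y ∈ e.baseSet := mem_baseSet_trivializationAt (Fib n) E y
  have h : ContMDiffOn (𝓡 d) 𝓘(ℝ, ℂ) ∞ (volFun s) e.baseSet := by
    have hdet : ContDiff ℝ ∞ (fun p : Fin n → Fib n => Matrix.det (Matrix.of fun i j => p j i)) := by
      simp only [Matrix.det_apply, Matrix.of_apply]
      fun_prop
    have hp : ContMDiffOn (𝓡 d) 𝓘(ℝ, Fin n → Fib n) ∞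
        (fun x j => e.linearMapAt ℂ x ((s j).1 x)) e.baseSet :=
      contMDiffOn_pi_space.mpr fun j => (s j).2 e
    exact (hdet.contMDiff.comp_contMDiffOn hp).congr fun x hx => volFun_eq s e hx
  exact h.contMDiffAt (e.open_baseSet.mem_nhds hy)

/-- The Hermitian product of sections, as an element of `C^∞(M) = Z(A)`. -/
def herm [IsSUBundle d n E] (s t : Sec d n E) : Ctr (EndSec d n E) :=
  scalar E (hermFun s t) (contMDiff_hermFun s t)

/-- The determinant of `n` sections, as an element of `C^∞(M) = Z(A)`. -/
def vol [IsSUBundle d n E] (s : Fin n → Sec d n E) : Ctr (EndSec d n E) :=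
  scalar E (volFun s) (contMDiff_volFun s)

/-! ### Connections -/

variable (d n E) in
/-- A connection on `𝓔`: a map `(X, s) ↦ ∇_X s`, which is `C^∞(M)`-linear in the vector field and
satisfies the Leibniz rule; recall `C^∞(M) = Z(A)`. -/
@[ext]
structure Connection where
  toFun : VF (EndSec d n E) → Sec d n E → Sec d n E
  add_field : ∀ X Y s, toFun (X + Y) s = toFun X s + toFun Y s
  smul_field : ∀ (f : Ctr (EndSec d n E)) X s, toFun (f • X) s = act f.1 (toFun X s)
  add_section : ∀ X s t, toFun X (s + t) = toFun X s + toFun X t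
  leibniz : ∀ X (f : Ctr (EndSec d n E)) s,
    toFun X (act f.1 s) = act (X f).1 s + act f.1 (toFun X s)

namespace Connection

/-- The volume form of the fibres is parallel (equivalently, the local connection forms are
traceless). -/
def PreservesVolume [IsSUBundle d n E] (D : Connection d n E) : Prop :=
  ∀ X s, X (vol s) = ∑ j, vol (Function.update s j (D.toFun X (s j)))

/-- `nab X` is the derivation `∇_X` of `A = Γ(End 𝓔)` given by the connection induced on `End 𝓔`:
`(∇_X a) s = ∇_X (a s) - a ∇_X s`. -/
def IsInducedOnEnd (D : Connection d n E)
    (nab : VF (EndSec d n E) →ₗ[Ctr (EndSec d n E)] Der (EndSec d n E)) : Prop :=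
  ∀ X a s, act ((nab X).1 a) s = D.toFun X (act a s) - act a (D.toFun X s)

end Connection

/-- Given the connection `nab` induced on `End 𝓔`, `α` is the associated noncommutative one-form:
`𝒳 = ∇_{ρ(𝒳)} - ad_{α(𝒳)}` with `α(𝒳)` traceless. -/
def IsConnectionForm [IsManifold (𝓡 d) ∞ M] [T2Space M] [IsSUBundle d n E]
    (nab : VF (EndSec d n E) →ₗ[Ctr (EndSec d n E)] Der (EndSec d n E))
    (α : Der (EndSec d n E) →ₗ[Ctr (EndSec d n E)] Traceless d n E) : Prop :=
  ∀ X, X = nab (rho X) - adTraceless d n E (α X)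

variable (d n E) in
/-- Homomorphisms of bimodules `Ω¹_Der(A) ⊗_A Ω¹_Der(A) → A` for `A = Γ(End 𝓔)`, where
`Ω¹_Der(A) = Hom_{Z(A)}(Der(A), A)`. -/
abbrev DerBimoduleForm :=
  BimoduleForm (Ctr (EndSec d n E)) (EndSec d n E) (Der (EndSec d n E))

/-- Orthogonality of the tensorial forms `μ ∘ ρ`, `μ ∈ Ω¹(M, End 𝓔) = Hom_{Z(A)}(Γ(TM), A)`, and
of the interior forms `η ∘ α`, `η ∈ Ω_Int(A) = Hom_{Z(A)}(A₀, A)`. -/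
def IsOrthogonal [IsManifold (𝓡 d) ∞ M] [T2Space M] [IsSUBundle d n E]
    (h : DerBimoduleForm d n E)
    (α : Der (EndSec d n E) →ₗ[Ctr (EndSec d n E)] Traceless d n E) : Prop :=
  ∀ (μ : Forms (Ctr (EndSec d n E)) (EndSec d n E) (VF (EndSec d n E)))
    (η : Forms (Ctr (EndSec d n E)) (EndSec d n E) (Traceless d n E)),
    h.toFun (pullback rho μ) (pullback α η) = 0

/-! ### Reality -/

section Reality

variable [IsSUBundle d n E]

/-- `b` is the adjoint `a^*` of `a` for the Hermitian structure. -/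
def IsAdj (a b : EndSec d n E) : Prop := ∀ s t, herm (act a s) t = herm s (act b t)

/-- Real vector fields: `X(f^*) = X(f)^*`. -/
def IsRealField (X : VF (EndSec d n E)) : Prop :=
  ∀ f g : Ctr (EndSec d n E), IsAdj f.1 g.1 → IsAdj (X f).1 (X g).1

/-- Real derivations: `𝒳(a^*) = 𝒳(a)^*`. -/
def IsRealDer (X : Der (EndSec d n E)) : Prop :=
  ∀ a b : EndSec d n E, IsAdj a b → IsAdj (X.1 a) (X.1 b)

/-- A form is real when its values on real derivations are Hermitian. -/
def IsRealForm (η : Forms (Ctr (EndSec d n E)) (EndSec d n E) (Der (EndSec d n E))) : Prop :=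
  ∀ X, IsRealDer X → IsAdj (η X) (η X)

/-- `h` is real when `h(η, θ)` is real for all real forms `η, θ` with central values. -/
def BimoduleForm.IsReal
    (h : DerBimoduleForm d n E) : Prop :=
  ∀ η θ, IsCentralForm η → IsCentralForm θ → IsRealForm η → IsRealForm θ →
    IsAdj (h.toFun η θ) (h.toFun η θ)

/-- The Hermitian structure is parallel: `X⟨s, t⟩ = ⟨∇_X s, t⟩ + ⟨s, ∇_X t⟩` for real `X`. A
connection which also preserves the volume form is an `SU(n)`-connection. -/
def Connection.IsHermitian (D : Connection d n E) : Prop :=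
  ∀ X, IsRealField X → ∀ s t,
    X (herm s t) = herm (D.toFun X s) t + herm s (D.toFun X t)

end Reality

end BundleDefs

end

end NCG

/-!
The metric `h` defines its own horizontal lift of vector fields. Nondegeneracy of `ρ_* h` attaches
to a vector field `X` the one-form `μ` on `M` with `(ρ_* h)(μ, ν) = ν(X)` for all `ν`. Since `h` is
nondegenerate, `h(μ ∘ ρ, ·)` is a left combination of evaluations at derivations; as `μ ∘ ρ` is
central, it takes central values on central forms, and replacing the coefficients of the combination
by their normalized traces shows that it is the evaluation at a single derivation
(`BimoduleForm.IsNondegenerate.exists_eval`). This derivation is the horizontal lift of `X`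
(`IsHorizontalLift`); it restricts to `X` on the centre and depends linearly on `X`. A comparison
with the orthogonality condition shows that the induced connections `∇` for which tensorial and
interior forms are orthogonal are exactly the horizontal lift (`isOrthogonal_of_isHorizontalLift`,
`IsOrthogonal.eq_of_isHorizontalLift`). Here and below, statements on all forms are reduced to
central forms, which generate the bimodule of forms locally over the matrix units of a frame
(`form_eq_zero_left`, `form_eq_zero_right`).

It remains to see that a section `∇` of `ρ` comes from a unique connection on `𝓔` which preserves
the volume form. Over the domain of a frame, a derivation `D` of `Γ(End 𝓔)` is the derivative of the
matrix entries along `ρ(D)` plus the commutator with a unique traceless `γ`, given explicitly by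
`γ = n⁻¹ ∑ D(e_ij) e_ji` (`LocalFrame.der_val`). The operators `s ↦ X s + γ s` are compatible with
`D = ∇_X` and preserve the volume form. Two operators with these properties agree, since their
difference is a multiple of the identity which acts trivially on the volume form
(`eq_of_leibniz_of_vol`); hence the local operators glue and the connection is unique
(`exists_connection`, `Connection.eq_of_isInducedOnEnd`). The same local description shows that
derivations vanishing on the centre are inner (`exists_adTraceless_eq`), so that the connection form
`α` exists.

Given the orthogonal connection, every form `θ` on `Der(A)` is the difference of `θ ∘ ∇ ∘ ρ` and
`θ ∘ ad ∘ α`. The mixed terms vanish, on both sides by symmetry, and the decomposition of `h` and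
the nondegeneracy of the two summands follow (`metric_splitting`).

If `h` is real and `X` is a real vector field, then its dual one-form is real
(`conjForm_eq_of_dual`). Applying `h(μ ∘ ρ, ·)` to the real forms `D ↦ tr(c D(a))` with `a` and `c`
Hermitian shows that the horizontal lift of `X` is a real derivation (`IsHorizontalLift.isRealDer`).
In a unitary frame this says that `γ` is skew-Hermitian (`LocalFrame.star_entry_gam`), that is, that
the connection is Hermitian.
-/

namespace NCG

noncomputable section

/-! ### Algebraic lemmas on matrix units and determinants -/

section Algebra

variable {n : ℕ}

/-- A family `δ i j` which behaves like the values of a derivation on matrix units `u i j` is given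
by the commutators with `γ = n⁻¹ ∑ δ i j * u j i`. -/
theorem matrixUnits_commutator [NeZero n] {R : Type*} [Ring R] [Algebra ℂ R]
    (u δ : Fin n → Fin n → R)
    (hu : ∀ i j k l, u i j * u k l = if j = k then u i l else 0) (h1 : ∑ i, u i i = 1)
    (hδ : ∀ i j k l, (if j = k then δ i l else 0) = u i j * δ k l + δ i j * u k l)
    (k l : Fin n) :
    δ k l = ((n : ℂ)⁻¹ • ∑ i, ∑ j, δ i j * u j i) * u k l -
      u k l * ((n : ℂ)⁻¹ • ∑ i, ∑ j, δ i j * u j i) := by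
  have hn : (n : ℂ) ≠ 0 := Nat.cast_ne_zero.mpr (NeZero.ne n)
  have e1 : (∑ i, ∑ j, δ i j * u j i) * u k l = ∑ j, δ k j * u j l := by
    simp only [Finset.sum_mul, mul_assoc, hu, mul_ite, mul_zero]
    rw [Finset.sum_comm]
    simp
  have e3 : ∀ i j, u k l * δ i j = (if l = i then δ k j else 0) - δ k l * u i j := fun i j =>
    eq_sub_of_add_eq (hδ k l i j).symm
  have e2 : u k l * (∑ i, ∑ j, δ i j * u j i) = (∑ j, δ k j * u j l) - (n : ℂ) • δ k l := by
    simp only [Finset.mul_sum, ← mul_assoc, e3, sub_mul, Finset.sum_sub_distrib]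
    congr 1
    · rw [Finset.sum_comm]
      simp [ite_mul]
    · simp only [mul_assoc, hu, if_true, Finset.sum_const, Finset.card_univ, Fintype.card_fin]
      rw [← Finset.smul_sum, ← Finset.mul_sum, h1, mul_one, Nat.cast_smul_eq_nsmul]
  rw [smul_mul_assoc, mul_smul_comm, e1, e2, smul_sub, inv_smul_smul₀ hn]
  abel

/-- The derivative of a determinant, computed column by column. -/
theorem derivation_det {R : Type*} [CommRing R] [Algebra ℂ R] (X : Derivation ℂ R R)
    (m : Matrix (Fin n) (Fin n) R) :
    X m.det = ∑ j, (m.updateCol j fun i => X (m i j)).det := by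
  have hp : ∀ (s : Finset (Fin n)) (f : Fin n → R),
      X (∏ i ∈ s, f i) = ∑ j ∈ s, X (f j) * ∏ i ∈ s.erase j, f i := by
    intro s f
    induction s using Finset.induction_on with
    | empty => simp
    | insert a s ha ih =>
      rw [Finset.prod_insert ha, Derivation.leibniz, ih, Finset.sum_insert ha,
        Finset.erase_insert ha, smul_eq_mul, smul_eq_mul, Finset.mul_sum, add_comm, mul_comm]
      congr 1
      refine Finset.sum_congr rfl fun j hj => ?_
      have hja : a ≠ j := fun h => ha (h ▸ hj)
      rw [Finset.erase_insert_of_ne hja, Finset.prod_insert fun h => ha (Finset.mem_of_mem_erase h)]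
      ring
  simp only [Matrix.det_apply, map_sum]
  rw [Finset.sum_comm]
  refine Finset.sum_congr rfl fun σ _ => ?_
  rw [← Finset.smul_sum, Units.smul_def, Units.smul_def, map_zsmul, hp]
  congr 1
  refine Finset.sum_congr rfl fun j _ => ?_
  rw [← Finset.mul_prod_erase _ _ (Finset.mem_univ j), Matrix.updateCol_self]
  congr 1
  refine Finset.prod_congr rfl fun i hi => ?_
  rw [Matrix.updateCol_ne (Finset.ne_of_mem_erase hi)]

/-- Applying a matrix to one column of a determinant at a time multiplies by the trace. -/
theorem sum_det_updateCol_mulVec {R : Type*} [CommRing R] (m g : Matrix (Fin n) (Fin n) R) :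
    ∑ j, (m.updateCol j (g.mulVec fun i => m i j)).det = g.trace * m.det := by
  have h : ∀ j, (m.updateCol j (g.mulVec fun i => m i j)).det = (m.adjugate * (g * m)) j j := by
    intro j
    rw [← Matrix.cramer_apply, Matrix.cramer_eq_adjugate_mulVec]
    rfl
  simp only [h]
  change Matrix.trace _ = _
  rw [← mul_assoc, Matrix.trace_mul_comm, ← mul_assoc, Matrix.mul_adjugate, smul_mul_assoc,
    one_mul, Matrix.trace_smul, smul_eq_mul, mul_comm]

end Algebra

/-! ### Nondegenerate bimodule forms -/

namespace BimoduleForm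

section General

variable {Z B N : Type*} [CommRing Z] [Ring B] [Algebra Z B] [AddCommGroup N] [Module Z N]
  (h : BimoduleForm Z B N)

/-- The additive map `θ ↦ h(θ, η)`. -/
def leftHom (η : Forms Z B N) : Forms Z B N →+ B :=
  AddMonoidHom.mk' (fun θ => h.toFun θ η) fun θ θ' => h.add_left θ θ' η

/-- The additive map `η ↦ h(θ, η)`. -/
def rightHom (θ : Forms Z B N) : Forms Z B N →+ B :=
  AddMonoidHom.mk' (h.toFun θ) (h.add_right θ)

theorem sub_left (θ θ' η : Forms Z B N) :
    h.toFun (θ - θ') η = h.toFun θ η - h.toFun θ' η := map_sub (h.leftHom η) θ θ'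

theorem sub_right (θ η η' : Forms Z B N) :
    h.toFun θ (η - η') = h.toFun θ η - h.toFun θ η' := map_sub (h.rightHom θ) η η'

/-- The image of `h^♯` is a left submodule, so it contains the span of the evaluations as soon as it
contains the evaluations. -/
theorem span_le_range (hX : ∀ X : N, ∃ θ, ∀ η, h.toFun θ η = η X) :
    (Submodule.span B (Set.range fun (X : N) (η : Forms Z B N) => η X) :
      Set (Forms Z B N → B)) ⊆ Set.range h.toFun := by
  intro ψ hψ
  induction hψ using Submodule.span_induction with
  | mem ψ hψ =>
    obtain ⟨X, rfl⟩ := hψ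
    obtain ⟨θ, hθ⟩ := hX X
    exact ⟨θ, funext hθ⟩
  | zero => exact ⟨0, funext fun η => map_zero (h.leftHom η)⟩
  | add ψ ψ' _ _ hψ hψ' =>
    obtain ⟨θ, rfl⟩ := hψ
    obtain ⟨θ', rfl⟩ := hψ'
    exact ⟨θ + θ', funext fun η => h.add_left θ θ' η⟩
  | smul b ψ _ hψ =>
    obtain ⟨θ, rfl⟩ := hψ
    exact ⟨lmul b θ, funext fun η => h.lmul_left b θ η⟩

/-- Conversely, the push-forward of `h` takes values in the span of the evaluations, as `h` does. -/
theorem range_push_le {N' : Type*} [AddCommGroup N'] [Module Z N'] (hh : h.IsNondegenerate)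
    (φ : N →ₗ[Z] N') : Set.range (h.push φ).toFun ⊆
      (Submodule.span B (Set.range fun (X : N') (η : Forms Z B N') => η X) :
        Set (Forms Z B N' → B)) := by
  have key : ∀ ψ ∈ Submodule.span B (Set.range fun (X : N) (η : Forms Z B N) => η X),
      (fun η => ψ (pullback φ η)) ∈
        Submodule.span B (Set.range fun (X : N') (η : Forms Z B N') => η X) := by
    intro ψ hψ
    induction hψ using Submodule.span_induction with
    | mem ψ hψ =>
      obtain ⟨X, rfl⟩ := hψ
      exact Submodule.subset_span ⟨φ X, rfl⟩
    | zero => exact Submodule.zero_mem _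
    | add ψ ψ' _ _ hψ hψ' => exact Submodule.add_mem _ hψ hψ'
    | smul b ψ _ hψ => exact Submodule.smul_mem _ b hψ
  rintro _ ⟨θ, rfl⟩
  exact key _ (hh.2.subset ⟨pullback φ θ, rfl⟩)

theorem IsSymmetric.push {h : BimoduleForm Z B N} (hh : h.IsSymmetric) {N' : Type*}
    [AddCommGroup N'] [Module Z N'] (φ : N →ₗ[Z] N') : (h.push φ).IsSymmetric :=
  fun _ _ hθ hη => hh _ _ (fun X => hθ (φ X)) (fun X => hη (φ X))

/-- The pull-back of forms as an additive map. -/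
def pullbackHom {N' : Type*} [AddCommGroup N'] [Module Z N'] (φ : N →ₗ[Z] N') :
    Forms Z B N' →+ Forms Z B N :=
  AddMonoidHom.mk' (pullback φ) fun _ _ => rfl

/-- If `σ` is a section of `φ` and `φ^* σ^*` is, with respect to `h`, an orthogonal projection onto
the image of `φ^*`, then `φ_* h` is nondegenerate together with `h`. -/
theorem IsNondegenerate.push {h : BimoduleForm Z B N} (hh : h.IsNondegenerate) {N' : Type*}
    [AddCommGroup N'] [Module Z N'] {φ : N →ₗ[Z] N'} {σ : N' →ₗ[Z] N} (hφ : ∀ X, φ (σ X) = X)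
    (hl : ∀ μ θ, h.toFun (pullback φ μ) θ = h.toFun (pullback φ μ) (pullback φ (pullback σ θ)))
    (hr : ∀ θ μ, h.toFun θ (pullback φ μ) = h.toFun (pullback φ (pullback σ θ)) (pullback φ μ)) :
    (h.push φ).IsNondegenerate := by
  have hσ : ∀ μ : Forms Z B N', pullback σ (pullback φ μ) = μ := fun μ =>
    LinearMap.ext fun X => congrArg μ (hφ X)
  refine ⟨fun μ μ' hμ => ?_, (h.range_push_le hh φ).antisymm
    ((h.push φ).span_le_range fun X => ?_)⟩
  · have h1 : pullback φ μ = pullback φ μ' := hh.1 (funext fun θ => by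
      rw [hl μ θ, hl μ' θ]
      exact congrFun hμ (pullback σ θ))
    rw [← hσ μ, h1, hσ]
  · have hev : (fun η : Forms Z B N => η (σ X)) ∈ Set.range h.toFun := by
      rw [hh.2]
      exact Submodule.subset_span ⟨σ X, rfl⟩
    obtain ⟨θ, hθ⟩ := hev
    refine ⟨pullback σ θ, fun ν => ?_⟩
    have h1 := congrFun hθ (pullback φ ν)
    rw [hr] at h1
    exact h1.trans (congrArg ν (hφ X))

/-! ### Forms on a module with an orthogonal splitting -/

section Splitting

variable {N₁ N₂ : Type*} [AddCommGroup N₁] [Module Z N₁] [AddCommGroup N₂] [Module Z N₂]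
  {h} {φ₁ : N →ₗ[Z] N₁} {σ₁ : N₁ →ₗ[Z] N} {φ₂ : N →ₗ[Z] N₂} {σ₂ : N₂ →ₗ[Z] N}

theorem form_eq_of_splitting (hX : ∀ X, X + σ₂ (φ₂ X) = σ₁ (φ₁ X)) (θ : Forms Z B N) :
    θ = pullback φ₁ (pullback σ₁ θ) - pullback φ₂ (pullback σ₂ θ) := by
  refine LinearMap.ext fun X => eq_sub_of_add_eq ?_
  change θ X + θ (σ₂ (φ₂ X)) = θ (σ₁ (φ₁ X))
  rw [← map_add, hX]

variable (hX : ∀ X, X + σ₂ (φ₂ X) = σ₁ (φ₁ X))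
  (h12 : ∀ μ η, h.toFun (pullback φ₁ μ) (pullback φ₂ η) = 0)
  (h21 : ∀ η μ, h.toFun (pullback φ₂ η) (pullback φ₁ μ) = 0)

include hX h12 h21

theorem eq_add_of_splitting (θ η : Forms Z B N) :
    h.toFun θ η = ((h.push φ₁).push σ₁).toFun θ η + ((h.push φ₂).push σ₂).toFun θ η := by
  conv_lhs => rw [form_eq_of_splitting hX θ, form_eq_of_splitting hX η]
  rw [h.sub_left, h.sub_right, h.sub_right, h12, h21, sub_zero, zero_sub, sub_neg_eq_add]
  rfl

theorem IsNondegenerate.push_fst (hh : h.IsNondegenerate) (h1 : ∀ X, φ₁ (σ₁ X) = X) :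
    (h.push φ₁).IsNondegenerate := by
  refine hh.push h1 (fun μ θ => ?_) fun θ μ => ?_
  · conv_lhs => rw [form_eq_of_splitting hX θ, h.sub_right, h12, sub_zero]
  · conv_lhs => rw [form_eq_of_splitting hX θ, h.sub_left, h21, sub_zero]

theorem IsNondegenerate.push_snd (hh : h.IsNondegenerate) (h2 : ∀ X, φ₂ (σ₂ X) = -X) :
    (h.push φ₂).IsNondegenerate := by
  have hσ : ∀ θ : Forms Z B N, pullback φ₂ (pullback (-σ₂) θ) =
      -pullback φ₂ (pullback σ₂ θ) := fun θ => LinearMap.ext fun X => map_neg θ _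
  refine hh.push (σ := -σ₂) (fun X => ?_) (fun μ θ => ?_) fun θ μ => ?_
  · rw [LinearMap.neg_apply, map_neg, h2, neg_neg]
  · conv_lhs => rw [form_eq_of_splitting hX θ, h.sub_right, h21, zero_sub]
    rw [hσ]
    exact (map_neg (h.rightHom _) _).symm
  · conv_lhs => rw [form_eq_of_splitting hX θ, h.sub_left, h12, zero_sub]
    rw [hσ]
    exact (map_neg (h.leftHom _) _).symm

end Splitting

end General

end BimoduleForm

section CentralForms

variable {A : Type*} [Ring A] [Algebra ℂ A] {N N' : Type*} [AddCommGroup N] [Module (Ctr A) N]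
  [AddCommGroup N'] [Module (Ctr A) N']

theorem isCentralForm_centralForm (μ : Forms (Ctr A) (Ctr A) N) :
    IsCentralForm (centralForm μ : Forms (Ctr A) A N) := fun X =>
  Subring.mem_center_iff.mpr fun b => Subalgebra.mem_center_iff.mp (μ X).2 b

theorem isCentralForm_pullback (φ : N →ₗ[Ctr A] N') (μ : Forms (Ctr A) (Ctr A) N') :
    IsCentralForm (pullback φ (centralForm μ) : Forms (Ctr A) A N) := fun X =>
  isCentralForm_centralForm μ (φ X)

theorem BimoduleForm.lmul_right (g : BimoduleForm (Ctr A) (Ctr A) N) (c : Ctr A)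
    (μ ν : Forms (Ctr A) (Ctr A) N) : g.toFun μ (lmul c ν) = c * g.toFun μ ν := by
  have hc : rmul μ c = lmul c μ := LinearMap.ext fun X => mul_comm (μ X) c
  rw [← g.balanced, hc, g.lmul_left]

end CentralForms

/-! ### Horizontal lifts of vector fields -/

section Lifts

variable {A : Type*} [Ring A] [Algebra ℂ A]

/-- The tautological form `D ↦ D a` on derivations of `A`. -/
def derEval (a : A) : Forms (Ctr A) A (Der A) where
  toFun D := D.1 a
  map_add' _ _ := rfl
  map_smul' _ _ := rfl

/-- The differential `df` of `f ∈ Z(A)`, that is, the form `X ↦ X f`. -/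
def vfEval (f : Ctr A) : Forms (Ctr A) (Ctr A) (VF A) where
  toFun X := X f
  map_add' _ _ := rfl
  map_smul' _ _ := rfl

/-- The central form `μ ∘ ρ` on `Der(A)` defined by a one-form `μ` on `M`. -/
abbrev basicForm (μ : Forms (Ctr A) (Ctr A) (VF A)) : Forms (Ctr A) A (Der A) :=
  pullback rho (centralForm μ)

theorem isCentralForm_basicForm (μ : Forms (Ctr A) (Ctr A) (VF A)) :
    IsCentralForm (basicForm μ) := fun X =>
  isCentralForm_centralForm μ (rho X)

/-- The restriction `ρ_* h` of `h` to one-forms on `M`. -/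
abbrev baseMetric (h : BimoduleForm (Ctr A) A (Der A)) : BimoduleForm (Ctr A) (Ctr A) (VF A) :=
  (h.push rho).restrictCenter

/-- `D` is the horizontal lift of the vector field `X` with respect to `h`: the one-form `μ`
metrically dual to `X` is such that `h(μ ∘ ρ, ·)` is the evaluation at `D`. -/
def IsHorizontalLift (h : BimoduleForm (Ctr A) A (Der A)) (X : VF A) (D : Der A) : Prop :=
  ∃ μ : Forms (Ctr A) (Ctr A) (VF A),
    (∀ ν, (baseMetric h).toFun μ ν = ν X) ∧
      ∀ η, h.toFun (basicForm μ) η = η D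

variable {h : BimoduleForm (Ctr A) A (Der A)}

theorem baseMetric_val (μ ν : Forms (Ctr A) (Ctr A) (VF A)) :
    ((baseMetric h).toFun μ ν).1 = h.toFun (basicForm μ) (basicForm ν) := rfl

theorem isHorizontalLift_of_eval {μ : Forms (Ctr A) (Ctr A) (VF A)} {D : Der A}
    (hD : ∀ η, h.toFun (basicForm μ) η = η D) :
    IsHorizontalLift h (rho D) D :=
  ⟨μ, fun ν => Subtype.ext (hD (basicForm ν)), hD⟩

/-- A horizontal lift restricts to the vector field on the centre: test it on differentials. -/
theorem IsHorizontalLift.rho_eq {X : VF A} {D : Der A} (hD : IsHorizontalLift h X D) :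
    rho D = X := by
  obtain ⟨μ, h1, h2⟩ := hD
  refine Derivation.ext fun f => Subtype.ext ?_
  have h3 := congrArg Subtype.val (h1 (vfEval f))
  exact (h2 (basicForm (vfEval f))).symm.trans h3

theorem IsHorizontalLift.unique (hM : (baseMetric h).IsNondegenerate) {X : VF A}
    {D D' : Der A} (hD : IsHorizontalLift h X D) (hD' : IsHorizontalLift h X D') : D = D' := by
  obtain ⟨μ, h1, h2⟩ := hD
  obtain ⟨μ', h1', h2'⟩ := hD'
  have hμ : μ = μ' := hM.1 (funext fun ν => (h1 ν).trans (h1' ν).symm)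
  subst hμ
  exact Subtype.ext (LinearMap.ext fun a => (h2 (derEval a)).symm.trans (h2' _))

theorem IsHorizontalLift.add {X X' : VF A} {D D' : Der A} (hD : IsHorizontalLift h X D)
    (hD' : IsHorizontalLift h X' D') : IsHorizontalLift h (X + X') (D + D') := by
  obtain ⟨μ, h1, h2⟩ := hD
  obtain ⟨μ', h1', h2'⟩ := hD'
  refine ⟨μ + μ', fun ν => ?_, fun η => ?_⟩
  · rw [BimoduleForm.add_left, h1, h1', map_add]
  · have h3 : basicForm (μ + μ') = basicForm μ + basicForm μ' :=
      LinearMap.ext fun Y => rfl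
    rw [h3, h.add_left, h2, h2', map_add]

theorem IsHorizontalLift.smul (z : Ctr A) {X : VF A} {D : Der A} (hD : IsHorizontalLift h X D) :
    IsHorizontalLift h (z • X) (z • D) := by
  obtain ⟨μ, h1, h2⟩ := hD
  refine ⟨lmul z μ, fun ν => ?_, fun η => ?_⟩
  · rw [BimoduleForm.lmul_left, h1, map_smul, smul_eq_mul]
  · rw [map_smul]
    refine (h.lmul_left z.1 (basicForm μ) η).trans ?_
    rw [h2]
    rfl

/-- Horizontal lifts are unique, hence linear in the vector field. -/
theorem exists_linear_horizontalLift (hM : (baseMetric h).IsNondegenerate)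
    (hX : ∀ X, ∃ D, IsHorizontalLift h X D) :
    ∃ nab : VF A →ₗ[Ctr A] Der A, ∀ X, IsHorizontalLift h X (nab X) := by
  choose f hf using hX
  exact ⟨{ toFun := f
           map_add' := fun X Y => (hf (X + Y)).unique hM ((hf X).add (hf Y))
           map_smul' := fun z X => (hf (z • X)).unique hM ((hf X).smul z) }, hf⟩

/-! ### The splitting of the derivations defined by a lift of the vector fields -/

variable {N : Type*} [AddCommGroup N] [Module (Ctr A) N] {nab : VF A →ₗ[Ctr A] Der A}
  {α : Der A →ₗ[Ctr A] N} {σ : N →ₗ[Ctr A] Der A}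

/-- A lift of the vector fields to derivations splits `Der(A)` if the kernel of `ρ` is the image of
an injective map `σ`. -/
theorem exists_connectionForm (hσ : Function.Injective σ)
    (hker : ∀ D D' : Der A, rho D = rho D' → ∃ γ, D + σ γ = D') (hn : ∀ X, rho (nab X) = X) :
    ∃ α : Der A →ₗ[Ctr A] N, ∀ D, D + σ (α D) = nab (rho D) := by
  have hex : ∀ D : Der A, ∃ γ, D + σ γ = nab (rho D) := fun D => hker _ _ (hn (rho D)).symm
  choose f hf using hex
  refine ⟨{ toFun := f
            map_add' := fun D D' => hσ ?_
            map_smul' := fun z D => hσ ?_ }, hf⟩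
  · refine add_left_cancel (a := D + D') ?_
    rw [hf, map_add, map_add, map_add, ← hf, ← hf, add_add_add_comm]
  · refine add_left_cancel (a := z • D) ?_
    rw [hf, map_smul, map_smul, RingHom.id_apply, map_smul, ← hf, smul_add]

/-- The form `α` defined by `D + σ (α D) = ∇_{ρ(D)}` vanishes on lifts of vector fields. -/
theorem connectionForm_lift (hα : ∀ D, D + σ (α D) = nab (rho D)) (hσ : Function.Injective σ)
    (hn : ∀ X, rho (nab X) = X) (X : VF A) : α (nab X) = 0 := by
  have h1 := hα (nab X)
  rw [hn] at h1
  exact hσ (by rw [map_zero]; exact add_eq_left.mp h1)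

/-- On the kernel of `ρ`, the form `α` defined by `D + σ (α D) = ∇_{ρ(D)}` is minus the inverse of
`σ`. -/
theorem connectionForm_inner (hα : ∀ D, D + σ (α D) = nab (rho D)) (hσ : Function.Injective σ)
    (hρ : ∀ γ, rho (σ γ) = 0) (γ : N) : α (σ γ) = -γ := by
  have h1 := hα (σ γ)
  rw [hρ, map_zero, ← map_add] at h1
  exact (neg_eq_of_add_eq_zero_right (hσ (by rw [h1, map_zero]))).symm

/-- Orthogonality forces the connection to be given by the horizontal lift. The form `ι` is only
used to detect that the value of the connection form vanishes. -/
theorem eq_of_isHorizontalLift (hα : ∀ D, D + σ (α D) = nab (rho D)) {ι : Forms (Ctr A) A N}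
    (hι : Function.Injective ι)
    (ho : ∀ (μ : Forms (Ctr A) A (VF A)) (η : Forms (Ctr A) A N),
      h.toFun (pullback rho μ) (pullback α η) = 0)
    {X : VF A} {D : Der A} (hD : IsHorizontalLift h X D) : nab X = D := by
  have hX := hD.rho_eq
  obtain ⟨μ, -, h2⟩ := hD
  have h3 : ι (α D) = 0 := (h2 (pullback α ι)).symm.trans (ho (centralForm μ) ι)
  have h4 : α D = 0 := hι (by rw [h3, map_zero])
  have h5 := hα D
  rw [h4, map_zero, add_zero, hX] at h5
  exact h5.symm

/-- For a splitting whose two summands are orthogonal with respect to the metric `h`, the metric is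
the sum of the metrics induced on the summands. -/
theorem metric_splitting (hh : h.IsMetric) (hα : ∀ D, D + σ (α D) = nab (rho D))
    (ho : ∀ (μ : Forms (Ctr A) A (VF A)) (η : Forms (Ctr A) A N),
      h.toFun (pullback rho μ) (pullback α η) = 0)
    (ho' : ∀ (η : Forms (Ctr A) A N) (μ : Forms (Ctr A) A (VF A)),
      h.toFun (pullback α η) (pullback rho μ) = 0)
    (hn : ∀ X, rho (nab X) = X) (hσ : ∀ γ, α (σ γ) = -γ) :
    (∀ θ η, h.toFun θ η =
        ((h.push rho).push nab).toFun θ η + ((h.push α).push σ).toFun θ η) ∧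
      (h.push rho).IsMetric ∧ (h.push α).IsMetric :=
  ⟨BimoduleForm.eq_add_of_splitting hα ho ho',
    ⟨hh.1.push rho, BimoduleForm.IsNondegenerate.push_fst hα ho ho' hh.2 hn⟩,
    ⟨hh.1.push α, BimoduleForm.IsNondegenerate.push_snd hα ho ho' hh.2 hσ⟩⟩

end Lifts

variable {d n : ℕ} {M : Type*} [TopologicalSpace M] [ChartedSpace (EuclideanSpace ℝ (Fin d)) M]
  {E : M → Type*} [∀ x, AddCommGroup (E x)] [∀ x, Module ℂ (E x)] [∀ x, TopologicalSpace (E x)]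
  [TopologicalSpace (TotalSpace (Fib n) E)] [FiberBundle (Fib n) E] [VectorBundle ℂ (Fib n) E]

local notation "𝒜" => EndSec d n E
local notation "𝒵" => Ctr (EndSec d n E)
local notation "𝒮" => Sec d n E

/-! ### Smooth sections and their values -/

theorem mem_sec_of_locally_eq (s : ∀ x, E x)
    (hs : ∀ y, ∃ V ∈ nhds y, ∃ t : 𝒮, ∀ x ∈ V, s x = t.1 x) : s ∈ Sec d n E := by
  intro e _ y hy
  obtain ⟨V, hV, t, ht⟩ := hs y
  refine (((t.2 e).contMDiffAt (e.open_baseSet.mem_nhds hy)).congr_of_eventuallyEq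
    ?_).contMDiffWithinAt
  filter_upwards [hV] with x hx
  rw [ht x hx]

theorem isSmoothEnd_of_locally_eq (a : ∀ x, Module.End ℂ (E x))
    (ha : ∀ y, ∃ V ∈ nhds y, ∃ b : 𝒜, ∀ x ∈ V, a x = b.val x) : IsSmoothEnd d n E a := by
  intro e _ v y hy
  obtain ⟨V, hV, b, hb⟩ := ha y
  refine (((b.smooth e v).contMDiffAt (e.open_baseSet.mem_nhds hy)).congr_of_eventuallyEq
    ?_).contMDiffWithinAt
  filter_upwards [hV] with x hx
  rw [hb x hx]

namespace EndSec

variable (d n E) in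
/-- Evaluation of sections of `End 𝓔` at a point, as a homomorphism of algebras. -/
def evalHom (x : M) : 𝒜 →ₐ[ℂ] Module.End ℂ (E x) where
  toFun a := a.val x
  map_one' := rfl
  map_mul' _ _ := rfl
  map_zero' := rfl
  map_add' _ _ := rfl
  commutes' _ := rfl

@[simp] theorem val_sub (a b : 𝒜) (x : M) : (a - b).val x = a.val x - b.val x := rfl

@[simp] theorem val_csmul (c : ℂ) (a : 𝒜) (x : M) : (c • a).val x = c • a.val x := rfl

@[simp] theorem val_sum {ι : Type*} (s : Finset ι) (a : ι → 𝒜) (x : M) :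
    (∑ i ∈ s, a i).val x = ∑ i ∈ s, (a i).val x := map_sum (evalHom d n E x) a s

end EndSec

@[simp] theorem act_val (a : 𝒜) (s : 𝒮) (x : M) : (act a s).1 x = a.val x (s.1 x) := rfl

theorem Sec.sum_val {ι : Type*} (t : Finset ι) (s : ι → 𝒮) (x : M) :
    (∑ i ∈ t, s i).1 x = ∑ i ∈ t, (s i).1 x := by
  rw [← Finset.sum_apply, ← Submodule.coe_sum]

theorem Sec.ext {s t : 𝒮} (h : ∀ x, s.1 x = t.1 x) : s = t := Subtype.ext (funext h)

/-- The basis of the fibre at `x` given by a trivialization around `x`. -/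
def frameBasis (e : Trivialization (Fib n) (π (Fib n) E)) [MemTrivializationAtlas e] (x : M)
    (hx : x ∈ e.baseSet) : Module.Basis (Fin n) ℂ (E x) :=
  (EuclideanSpace.basisFun (Fin n) ℂ).toBasis.map (e.linearEquivAt ℂ x hx).symm

theorem frameBasis_apply (e : Trivialization (Fib n) (π (Fib n) E)) [MemTrivializationAtlas e]
    (x : M) (hx : x ∈ e.baseSet) (i : Fin n) :
    frameBasis e x hx i = e.symm x (EuclideanSpace.single i 1) := by
  simp [frameBasis]

theorem frameBasis_repr (e : Trivialization (Fib n) (π (Fib n) E)) [MemTrivializationAtlas e]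
    (x : M) (hx : x ∈ e.baseSet) (v : E x) (i : Fin n) :
    (frameBasis e x hx).repr v i = e.linearMapAt ℂ x v i := by
  simp [frameBasis, e.coe_linearMapAt_of_mem hx]

/-! ### The centre as the algebra of smooth functions -/

theorem contMDiff_trace (a : 𝒜) :
    ContMDiff (𝓡 d) 𝓘(ℝ, ℂ) ∞ (fun x => LinearMap.trace ℂ (E x) (a.val x)) := by
  intro y
  set e := trivializationAt (Fib n) E y
  have hy : y ∈ e.baseSet := mem_baseSet_trivializationAt (Fib n) E y
  have h : ContMDiffOn (𝓡 d) 𝓘(ℝ, ℂ) ∞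
      (fun x => LinearMap.trace ℂ (E x) (a.val x)) e.baseSet := by
    have key : ∀ x ∈ e.baseSet, LinearMap.trace ℂ (E x) (a.val x) =
        ∑ i, (e.linearMapAt ℂ x (a.val x (e.symm x (EuclideanSpace.single i 1)))) i := by
      intro x hx
      rw [LinearMap.trace_eq_matrix_trace ℂ (frameBasis e x hx), Matrix.trace]
      refine Finset.sum_congr rfl fun i _ => ?_
      rw [Matrix.diag_apply, LinearMap.toMatrix_apply, frameBasis_repr, frameBasis_apply]
    refine ContMDiffOn.congr ?_ key
    refine contMDiffOn_finsetSum fun i _ => ?_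
    have hp : ContMDiff 𝓘(ℝ, Fib n) 𝓘(ℝ, ℂ) ∞ (fun v : Fib n => v i) :=
      ((EuclideanSpace.proj (𝕜 := ℂ) i : Fib n →L[ℂ] ℂ).restrictScalars ℝ).contDiff.contMDiff
    exact hp.comp_contMDiffOn (a.smooth e _)
  exact h.contMDiffAt (e.open_baseSet.mem_nhds hy)

theorem finrank_fibre (x : M) : Module.finrank ℂ (E x) = n := by
  have := Module.finrank_eq_card_basis
    (frameBasis (trivializationAt (Fib n) E x) x (mem_baseSet_trivializationAt (Fib n) E x))
  simpa using this

theorem trace_smul_id (x : M) (c : ℂ) :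
    LinearMap.trace ℂ (E x) (c • LinearMap.id) = c * n := by
  have : Module.Finite ℂ (E x) := Module.Finite.of_basis
    (frameBasis (trivializationAt (Fib n) E x) x (mem_baseSet_trivializationAt (Fib n) E x))
  rw [map_smul, LinearMap.trace_id, finrank_fibre (n := n), smul_eq_mul]

/-- A function which is smooth on `U ∩ W` becomes smooth on `W` after multiplication by a function
supported in `U`. -/
theorem contMDiffOn_cutoff {G : Type*} [NormedAddCommGroup G] [NormedSpace ℝ G] {f : M → ℝ}
    (hf : ContMDiff (𝓡 d) 𝓘(ℝ, ℝ) ∞ f) {U W : Set M} (hU : IsOpen U) (hW : IsOpen W)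
    (hfU : tsupport f ⊆ U) {g : M → G} (hg : ContMDiffOn (𝓡 d) 𝓘(ℝ, G) ∞ g (U ∩ W)) :
    ContMDiffOn (𝓡 d) 𝓘(ℝ, G) ∞ (fun x => f x • g x) W := by
  intro y hy
  by_cases hyf : y ∈ tsupport f
  · have hV : U ∩ W ∈ nhds y := (hU.inter hW).mem_nhds ⟨hfU hyf, hy⟩
    exact ((hf.contMDiffOn.smul hg).contMDiffAt hV).contMDiffWithinAt
  · have hV : (tsupport f)ᶜ ∈ nhds y := (isClosed_tsupport f).isOpen_compl.mem_nhds hyf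
    have h0 : (fun x => f x • g x) =ᶠ[nhds y] fun _ => 0 := by
      filter_upwards [hV] with x hx
      rw [image_eq_zero_of_notMem_tsupport hx, zero_smul]
    exact (contMDiffAt_const.congr_of_eventuallyEq h0).contMDiffWithinAt

theorem rho_apply_val (D : Der 𝒜) (z : 𝒵) : (rho D z).1 = D.1 z.1 := rfl

/-- The Leibniz rule for multiplication by a function. -/
theorem der_center_smul (D : Der 𝒜) (z : 𝒵) (a : 𝒜) :
    D.1 (z • a) = rho D z • a + z • D.1 a := by
  have h := D.2 z.1 a
  rw [add_comm]
  exact h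

variable [IsManifold (𝓡 d) ∞ M] [T2Space M] [IsSUBundle d n E] [NeZero n]

variable (d n E) in
/-- The value of a central element of `Γ(End 𝓔)` at a point, under `Z(A) = C^∞(M)`; it is
read off from the trace. -/
def ptEval (x : M) : 𝒵 →ₐ[ℂ] ℂ where
  toFun z := (n : ℂ)⁻¹ * LinearMap.trace ℂ (E x) (z.1.val x)
  map_one' := by
    have h0 : (n : ℂ) ≠ 0 := Nat.cast_ne_zero.mpr (NeZero.ne n)
    have h : ((1 : 𝒵).1.val x) = (1 : ℂ) • LinearMap.id := (one_smul ℂ _).symm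
    rw [h, trace_smul_id (n := n), one_mul, inv_mul_cancel₀ h0]
  map_mul' z w := by
    have h0 : (n : ℂ) ≠ 0 := Nat.cast_ne_zero.mpr (NeZero.ne n)
    obtain ⟨a, ha⟩ := center_scalar z x
    obtain ⟨b, hb⟩ := center_scalar w x
    have h : ((z * w).1.val x) = (a * b) • LinearMap.id := by
      change z.1.val x * w.1.val x = _
      rw [ha, hb]
      ext v
      simp [smul_smul, mul_comm]
    rw [h, ha, hb]
    simp only [trace_smul_id (n := n)]
    field_simp
  map_zero' := by simp
  map_add' z w := by simp [mul_add]
  commutes' c := by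
    have h0 : (n : ℂ) ≠ 0 := Nat.cast_ne_zero.mpr (NeZero.ne n)
    have h : ((algebraMap ℂ 𝒵 c).1.val x) = c • LinearMap.id := rfl
    rw [h, trace_smul_id (n := n), mul_comm c, inv_mul_cancel_left₀ h0]
    rfl

theorem center_val (z : 𝒵) (x : M) : z.1.val x = ptEval d n E x z • LinearMap.id := by
  have h0 : (n : ℂ) ≠ 0 := Nat.cast_ne_zero.mpr (NeZero.ne n)
  obtain ⟨a, ha⟩ := center_scalar z x
  have h : ptEval d n E x z = (n : ℂ)⁻¹ * LinearMap.trace ℂ (E x) (z.1.val x) := rfl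
  rw [h, ha, trace_smul_id (n := n), mul_comm a, inv_mul_cancel_left₀ h0]

theorem center_val_apply (z : 𝒵) (x : M) (v : E x) : z.1.val x v = ptEval d n E x z • v := by
  rw [center_val]; rfl

theorem center_ext {z w : 𝒵} (h : ∀ x, ptEval d n E x z = ptEval d n E x w) : z = w := by
  refine Subtype.ext (EndSec.ext fun x => ?_)
  rw [center_val, center_val, h]

theorem contMDiff_ptEval (z : 𝒵) :
    ContMDiff (𝓡 d) 𝓘(ℝ, ℂ) ∞ (fun x => ptEval d n E x z) :=
  ((ContinuousLinearMap.mul ℝ ℂ (n : ℂ)⁻¹).contDiff.contMDiff).comp (contMDiff_trace z.1)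

@[simp] theorem ptEval_scalar (f : M → ℂ) (hf : ContMDiff (𝓡 d) 𝓘(ℝ, ℂ) ∞ f) (x : M) :
    ptEval d n E x (scalar E f hf) = f x := by
  have h0 : (n : ℂ) ≠ 0 := Nat.cast_ne_zero.mpr (NeZero.ne n)
  have h : ptEval d n E x (scalar E f hf) =
    (n : ℂ)⁻¹ * LinearMap.trace ℂ (E x) (f x • LinearMap.id) := rfl
  rw [h, trace_smul_id (n := n), mul_comm (f x), inv_mul_cancel_left₀ h0]

/-- The action of the centre on `Γ(End 𝓔)`, pointwise. -/
@[simp] theorem val_center_smul (z : 𝒵) (a : 𝒜) (x : M) :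
    (z • a).val x = ptEval d n E x z • a.val x := by
  change z.1.val x * a.val x = _
  rw [center_val]
  ext v
  simp

variable (d n E) in
/-- The fibrewise trace `Γ(End 𝓔) → C^∞(M)`. -/
def tr : 𝒜 →ₗ[𝒵] 𝒵 where
  toFun a := scalar E _ (contMDiff_trace a)
  map_add' a b := center_ext fun x => by simp
  map_smul' z a := center_ext fun x => by simp

@[simp] theorem ptEval_tr (a : 𝒜) (x : M) :
    ptEval d n E x (tr d n E a) = LinearMap.trace ℂ (E x) (a.val x) :=
  ptEval_scalar _ (contMDiff_trace a) _

/-- A traceless endomorphism of a fibre which commutes with all sections of `End 𝓔` vanishes. -/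
theorem eq_zero_of_commute_of_trace {x : M} {T : Module.End ℂ (E x)}
    (hT : ∀ a : 𝒜, T * a.val x = a.val x * T) (h0 : LinearMap.trace ℂ (E x) T = 0) : T = 0 := by
  have hn : (n : ℂ) ≠ 0 := Nat.cast_ne_zero.mpr (NeZero.ne n)
  have hc : T ∈ Subalgebra.center ℂ (Module.End ℂ (E x)) := by
    rw [Subalgebra.mem_center_iff]
    intro b
    obtain ⟨a, rfl⟩ := exists_end_eq (d := d) (n := n) x b
    exact (hT a).symm
  rw [Algebra.IsCentral.center_eq_bot, Algebra.mem_bot] at hc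
  obtain ⟨c, rfl⟩ := hc
  have h : algebraMap ℂ (Module.End ℂ (E x)) c = c • LinearMap.id := rfl
  rw [h, trace_smul_id (n := n)] at h0
  rw [h, (mul_eq_zero.mp h0).resolve_right hn, zero_smul]

/-- A real smooth bump function, as a central element: it equals `1` near `x` and vanishes
off `V`. -/
theorem exists_real_bump {x : M} {V : Set M} (hV : V ∈ nhds x) :
    ∃ ψ : 𝒵, (∀ᶠ y in nhds x, ptEval d n E y ψ = 1) ∧ (∀ y ∉ V, ptEval d n E y ψ = 0) ∧
      ∀ y, star (ptEval d n E y ψ) = ptEval d n E y ψ := by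
  obtain ⟨f, -, hf⟩ := (SmoothBumpFunction.nhds_basis_tsupport (I := 𝓡 d) x).mem_iff.mp hV
  have hs : ContMDiff (𝓡 d) 𝓘(ℝ, ℂ) ∞ (fun x => ((f x : ℝ) : ℂ)) :=
    Complex.ofRealCLM.contDiff.contMDiff.comp f.contMDiff
  refine ⟨scalar E _ hs, ?_, fun y hy => ?_, fun y => ?_⟩
  · filter_upwards [f.eventuallyEq_one] with y hy
    rw [ptEval_scalar, hy, Pi.one_apply, Complex.ofReal_one]
  · have : f y = 0 := image_eq_zero_of_notMem_tsupport fun h => hy (hf h)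
    rw [ptEval_scalar, this, Complex.ofReal_zero]
  · rw [ptEval_scalar]
    exact Complex.conj_ofReal _

theorem exists_bump {x : M} {V : Set M} (hV : V ∈ nhds x) :
    ∃ ψ : 𝒵, ptEval d n E x ψ = 1 ∧ ∀ y ∉ V, ptEval d n E y ψ = 0 := by
  obtain ⟨ψ, h1, h0, -⟩ := exists_real_bump (d := d) (n := n) (E := E) hV
  exact ⟨ψ, h1.self_of_nhds, h0⟩

/-! ### Derivations are local -/

theorem vf_congr (X : VF 𝒜) {f g : 𝒵} {x : M}
    (h : ∀ᶠ y in nhds x, ptEval d n E y f = ptEval d n E y g) :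
    ptEval d n E x (X f) = ptEval d n E x (X g) := by
  obtain ⟨ψ, h1, h0⟩ := exists_bump (d := d) (n := n) (E := E) h
  have hz : ψ * (f - g) = 0 := center_ext fun y => by
    by_cases hy : ptEval d n E y f = ptEval d n E y g
    · simp [hy]
    · simp [h0 y hy]
  have h2 := congrArg (fun z => ptEval d n E x (X z)) hz
  simp only [Derivation.leibniz, map_add, map_sub, map_zero, smul_eq_mul, map_mul, h1,
    h.self_of_nhds] at h2
  linear_combination h2

theorem der_congr (D : Der 𝒜) {a b : 𝒜} {x : M}
    (h : ∀ᶠ y in nhds x, a.val y = b.val y) : (D.1 a).val x = (D.1 b).val x := by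
  obtain ⟨ψ, h1, h0⟩ := exists_bump (d := d) (n := n) (E := E) h
  have hz : ψ • (a - b) = 0 := EndSec.ext fun y => by
    by_cases hy : a.val y = b.val y
    · simp [hy]
    · simp [h0 y hy]
  have h2 := congrArg (fun z => (D.1 z).val x) hz
  simp only [der_center_smul, map_sub, map_zero, EndSec.val_add, EndSec.val_sub, EndSec.val_zero,
    val_center_smul, h1, h.self_of_nhds, sub_self, smul_zero, zero_add, one_smul] at h2
  exact sub_eq_zero.mp h2

/-! ### Local unitary frames -/

variable (d n E) in
/-- A local unitary frame of `𝓔` over an open set `V`, together with global sections `sec i` of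
`𝓔`, global functions `coord i s` and global sections `unit i j` of `End 𝓔` which over `V` are the
vectors of the frame, the components of `s`, and the matrix units of the frame. -/
structure LocalFrame where
  V : Set M
  isOpen : IsOpen V
  basis : ∀ x ∈ V, Module.Basis (Fin n) ℂ (E x)
  sec : Fin n → 𝒮
  coord : Fin n → 𝒮 → 𝒵
  unit : Fin n → Fin n → 𝒜
  sec_val : ∀ x hx i, (sec i).1 x = basis x hx i
  ptEval_coord : ∀ x hx i s, ptEval d n E x (coord i s) = (basis x hx).repr (s.1 x) i
  unit_val : ∀ x hx i j v, (unit i j).val x v = (basis x hx).repr v j • basis x hx i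
  hermFun_val : ∀ x hx (s t : 𝒮), hermFun s t x =
    ∑ i, star ((basis x hx).repr (s.1 x) i) * (basis x hx).repr (t.1 x) i
  volFun_val : ∀ x hx (s : Fin n → 𝒮), volFun s x =
    Matrix.det (Matrix.of fun i j => (basis x hx).repr ((s j).1 x) i)

theorem exists_localFrame (y : M) : ∃ F : LocalFrame d n E, y ∈ F.V := by
  set e := trivializationAt (Fib n) E y with he
  have hy : y ∈ e.baseSet := mem_baseSet_trivializationAt (Fib n) E y
  obtain ⟨f, -, hf⟩ := (SmoothBumpFunction.nhds_basis_tsupport (I := 𝓡 d) y).mem_iff.mp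
    (e.open_baseSet.mem_nhds hy)
  have hfs : ContMDiff (𝓡 d) 𝓘(ℝ, ℝ) ∞ f := f.contMDiff
  have hproj : ∀ i, ContMDiff 𝓘(ℝ, Fib n) 𝓘(ℝ, ℂ) ∞ (fun v : Fib n => v i) := fun i =>
    ((EuclideanSpace.proj (𝕜 := ℂ) i : Fib n →L[ℂ] ℂ).restrictScalars ℝ).contDiff.contMDiff
  have hcoord : ∀ i (s : 𝒮), ContMDiff (𝓡 d) 𝓘(ℝ, ℂ) ∞
      (fun x => f x • (e.linearMapAt ℂ x (s.1 x)) i) := by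
    intro i s
    rw [← contMDiffOn_univ]
    refine contMDiffOn_cutoff hfs e.open_baseSet isOpen_univ hf ?_
    rw [Set.inter_univ]
    exact (hproj i).comp_contMDiffOn (s.2 e)
  have hsec : ∀ i, (fun x => ((f x : ℝ) : ℂ) • e.symm x (EuclideanSpace.single i 1)) ∈
      Sec d n E := by
    intro i e' _
    refine (contMDiffOn_cutoff hfs e.open_baseSet e'.open_baseSet hf
      (IsSUBundle.smooth e e' (EuclideanSpace.single i 1))).congr fun x hx => ?_
    by_cases hxe : x ∈ e.baseSet
    · rw [map_smul, Complex.coe_smul, e.coordChangeL_apply e' ⟨hxe, hx⟩,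
        e'.coe_linearMapAt_of_mem hx]
    · have h0 : f x = 0 := image_eq_zero_of_notMem_tsupport fun h => hxe (hf h)
      simp [h0]
  let sec : Fin n → 𝒮 := fun i => ⟨_, hsec i⟩
  have hunit : ∀ i j, IsSmoothEnd d n E (fun x =>
      ((f x • (EuclideanSpace.proj j : Fib n →L[ℂ] ℂ).toLinearMap.comp
        (e.linearMapAt ℂ x) : E x →ₗ[ℂ] ℂ)).smulRight ((sec i).1 x)) := by
    intro i j e' _ v
    have h1 : ContMDiffOn (𝓡 d) 𝓘(ℝ, ℂ) ∞ (fun x => f x • (e'.coordChangeL ℂ e x v) j)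
        e'.baseSet := by
      refine contMDiffOn_cutoff hfs e.open_baseSet e'.open_baseSet hf ?_
      exact (hproj j).comp_contMDiffOn
        ((IsSUBundle.smooth e' e v).mono fun x hx => ⟨hx.2, hx.1⟩)
    refine (contMDiffOn_smulC h1 ((sec i).2 e')).congr fun x hx => ?_
    by_cases hxe : x ∈ e.baseSet
    · rw [LinearMap.smulRight_apply, map_smul, e'.coordChangeL_apply e ⟨hx, hxe⟩,
        LinearMap.smul_apply, LinearMap.comp_apply, e.coe_linearMapAt_of_mem hxe]
      rfl
    · have h0 : f x = 0 := image_eq_zero_of_notMem_tsupport fun h => hxe (hf h)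
      simp [h0]
  -- The cut-off disappears on the interior of `{f = 1}`, which is the domain of the frame.
  have hV : interior {x | f x = 1} ⊆ e.baseSet := fun x hx => by
    by_contra h
    have h1 : f x = 1 := interior_subset (s := {x | f x = 1}) hx
    rw [image_eq_zero_of_notMem_tsupport fun h' => h (hf h')] at h1
    exact zero_ne_one h1
  have h1 : ∀ x ∈ interior {x | f x = 1}, f x = 1 := fun x hx =>
    interior_subset (s := {x | f x = 1}) hx
  refine ⟨⟨interior {x | f x = 1}, isOpen_interior, fun x hx => frameBasis e x (hV hx), sec,
    fun i s => scalar E _ (hcoord i s), fun i j => EndSec.mk _ (hunit i j), ?_, ?_, ?_, ?_, ?_⟩,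
    mem_interior_iff_mem_nhds.mpr f.eventuallyEq_one⟩
  · intro x hx i
    simp [sec, h1 x hx, frameBasis_apply]
  · intro x hx i s
    rw [ptEval_scalar, h1 x hx, one_smul, frameBasis_repr]
  · intro x hx i j v
    rw [frameBasis_repr, frameBasis_apply]
    simp [sec, h1 x hx]
  · intro x hx s t
    rw [hermFun_eq s t e (hV hx), PiLp.inner_apply]
    refine Finset.sum_congr rfl fun i _ => ?_
    rw [frameBasis_repr, frameBasis_repr]
    simp [mul_comm]
  · intro x hx s
    rw [volFun_eq s e (hV hx)]
    simp only [frameBasis_repr]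

/-! ### Matrix entries in a local frame -/

namespace LocalFrame

variable (F : LocalFrame d n E)

/-- The matrix entries of a section of `End 𝓔` in a local frame. -/
def entry (k l : Fin n) : 𝒜 →ₗ[𝒵] 𝒵 := (tr d n E).comp (LinearMap.mulLeft 𝒵 (F.unit l k))

/-- The endomorphism `n⁻¹ ∑ D(e_ij) e_ji` attached to a derivation `D` of `Γ(End 𝓔)`: over the
domain of the frame it is traceless and `D` differs from `[γ, ·]` by the derivative of the matrix
entries. -/
def gam (D : Der 𝒜) : 𝒜 := (n : ℂ)⁻¹ • ∑ i, ∑ j, D.1 (F.unit i j) * F.unit j i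

variable {F} {x : M} (hx : x ∈ F.V)

include hx

theorem ptEval_entry (k l : Fin n) (a : 𝒜) :
    ptEval d n E x (F.entry k l a) = (F.basis x hx).repr (a.val x (F.basis x hx l)) k := by
  change ptEval d n E x (tr d n E (F.unit l k * a)) = _
  rw [ptEval_tr, LinearMap.trace_eq_matrix_trace ℂ (F.basis x hx), Matrix.trace,
    Finset.sum_eq_single l]
  · rw [Matrix.diag_apply, LinearMap.toMatrix_apply, EndSec.val_mul, Module.End.mul_apply,
      F.unit_val x hx]
    simp
  · intro i _ hi
    rw [Matrix.diag_apply, LinearMap.toMatrix_apply, EndSec.val_mul, Module.End.mul_apply,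
      F.unit_val x hx]
    simp [hi.symm]
  · simp

theorem repr_val (a : 𝒜) (v : E x) (i : Fin n) : (F.basis x hx).repr (a.val x v) i =
    ∑ j, ptEval d n E x (F.entry i j a) * (F.basis x hx).repr v j := by
  conv_lhs => rw [← (F.basis x hx).sum_repr v]
  simp only [map_sum, map_smul, Finsupp.finsetSum_apply, Finsupp.smul_apply, smul_eq_mul,
    ptEval_entry hx]
  exact Finset.sum_congr rfl fun j _ => mul_comm _ _

theorem val_eq_sum (a : 𝒜) :
    a.val x = (∑ k, ∑ l, F.entry k l a • F.unit k l).val x := by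
  refine LinearMap.ext fun v => (F.basis x hx).ext_elem fun i => ?_
  rw [repr_val hx]
  simp only [EndSec.val_sum, val_center_smul, LinearMap.sum_apply, LinearMap.smul_apply,
    F.unit_val x hx, map_sum, map_smul, Finsupp.finsetSum_apply, Finsupp.smul_apply,
    Module.Basis.repr_self, smul_eq_mul]
  symm
  rw [Finset.sum_eq_single i]
  · simp
  · intro k _ hk
    simp [hk.symm]
  · simp

theorem unit_mul_unit (i j k l : Fin n) :
    (F.unit i j).val x * (F.unit k l).val x = if j = k then (F.unit i l).val x else 0 := by
  refine LinearMap.ext fun v => ?_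
  rw [Module.End.mul_apply, F.unit_val x hx, F.unit_val x hx]
  by_cases h : j = k
  · subst h
    simp [F.unit_val x hx]
  · simp [h]

theorem sum_unit : ∑ i, (F.unit i i).val x = 1 := by
  refine LinearMap.ext fun v => ?_
  simp only [LinearMap.sum_apply, F.unit_val x hx, Module.End.one_apply]
  exact (F.basis x hx).sum_repr v

/-- The Leibniz rule for the products of matrix units, which only hold over the domain of the
frame. -/
theorem der_unit (D : Der 𝒜) (i j k l : Fin n) :
    (if j = k then (D.1 (F.unit i l)).val x else 0) =
      (F.unit i j).val x * (D.1 (F.unit k l)).val x +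
        (D.1 (F.unit i j)).val x * (F.unit k l).val x := by
  rw [← EndSec.val_mul, ← EndSec.val_mul, ← EndSec.val_add, ← D.2]
  have h : ∀ᶠ y in nhds x, (F.unit i j * F.unit k l).val y =
      (if j = k then F.unit i l else 0 : 𝒜).val y := by
    filter_upwards [F.isOpen.mem_nhds hx] with y hy
    rw [EndSec.val_mul, unit_mul_unit hy]
    split_ifs <;> simp
  rw [der_congr D h]
  split_ifs <;> simp

omit hx in
theorem gam_val (D : Der 𝒜) : (F.gam D).val x =
    (n : ℂ)⁻¹ • ∑ i, ∑ j, (D.1 (F.unit i j)).val x * (F.unit j i).val x := by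
  simp [gam]

theorem der_unit_val (D : Der 𝒜) (k l : Fin n) :
    (D.1 (F.unit k l)).val x =
      (F.gam D).val x * (F.unit k l).val x - (F.unit k l).val x * (F.gam D).val x := by
  rw [gam_val]
  exact matrixUnits_commutator (fun i j => (F.unit i j).val x) (fun i j => (D.1 (F.unit i j)).val x)
    (unit_mul_unit hx) (sum_unit hx) (der_unit hx D) k l

theorem trace_gam (D : Der 𝒜) : LinearMap.trace ℂ (E x) ((F.gam D).val x) = 0 := by
  have hn : (n : ℂ) ≠ 0 := Nat.cast_ne_zero.mpr (NeZero.ne n)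
  have h := congrArg (LinearMap.trace ℂ (E x)) (gam_val (F := F) D)
  set g := (F.gam D).val x
  have h2 : ∀ i j, LinearMap.trace ℂ (E x) ((D.1 (F.unit i j)).val x * (F.unit j i).val x) =
      LinearMap.trace ℂ (E x) (g * (F.unit i i).val x) -
        LinearMap.trace ℂ (E x) (g * (F.unit j j).val x) := by
    intro i j
    rw [der_unit_val hx, sub_mul, map_sub, mul_assoc, unit_mul_unit hx, if_pos rfl,
      mul_assoc, LinearMap.trace_mul_comm _ _ (_ * _), mul_assoc, unit_mul_unit hx, if_pos rfl]
  simp only [map_smul, map_sum, h2, Finset.sum_sub_distrib] at h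
  rw [h, Finset.sum_comm, sub_self, smul_zero]

/-- In a local frame a derivation is the sum of the derivative of the matrix entries and of a
commutator. -/
theorem der_val (D : Der 𝒜) (a : 𝒜) : (D.1 a).val x =
    (∑ k, ∑ l, rho D (F.entry k l a) • F.unit k l).val x +
      ((F.gam D).val x * a.val x - a.val x * (F.gam D).val x) := by
  have h : ∀ᶠ y in nhds x, a.val y = (∑ k, ∑ l, F.entry k l a • F.unit k l).val y := by
    filter_upwards [F.isOpen.mem_nhds hx] with y hy using val_eq_sum hy a
  rw [der_congr D h]
  conv_rhs => rw [val_eq_sum hx a]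
  simp only [map_sum, der_center_smul, EndSec.val_sum, EndSec.val_add, val_center_smul,
    der_unit_val hx, Finset.sum_add_distrib, Finset.mul_sum, Finset.sum_mul, smul_sub,
    Finset.sum_sub_distrib, mul_smul_comm, smul_mul_assoc]

end LocalFrame

/-! ### Bimodule maps are determined by central forms -/

/-- Up to a bump function, every section of `End 𝓔` is near `x` a combination of the matrix units of
a frame with central coefficients. -/
theorem exists_local_decomposition (x : M) : ∃ (ψ : 𝒵) (_ : ptEval d n E x ψ = 1)
    (u : Fin n → Fin n → 𝒜) (t : Fin n → Fin n → 𝒜 →ₗ[𝒵] 𝒵),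
    ∀ b, ψ • b = ∑ k, ∑ l, t k l b • u k l := by
  obtain ⟨F, hx⟩ := exists_localFrame (d := d) (n := n) (E := E) x
  obtain ⟨ψ, h1, h0⟩ := exists_bump (d := d) (n := n) (E := E) (F.isOpen.mem_nhds hx)
  refine ⟨ψ, h1, fun k l => ψ • F.unit k l, F.entry, fun b => EndSec.ext fun y => ?_⟩
  by_cases hy : y ∈ F.V
  · rw [val_center_smul, LocalFrame.val_eq_sum hy b]
    simp only [EndSec.val_sum, val_center_smul, Finset.smul_sum]
    exact Finset.sum_congr rfl fun k _ => Finset.sum_congr rfl fun l _ => smul_comm _ _ _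
  · simp [h0 y hy]

section FormExt

variable {N : Type*} [AddCommGroup N] [Module (Ctr (EndSec d n E)) N]

/-- Central forms generate the left module of forms, locally. -/
theorem form_eq_zero_left (T : Forms 𝒵 𝒜 N →+ 𝒜) (hT : ∀ a θ, T (lmul a θ) = a * T θ)
    (h0 : ∀ μ : Forms 𝒵 𝒵 N, T (centralForm μ) = 0) (θ : Forms 𝒵 𝒜 N) : T θ = 0 := by
  refine EndSec.ext fun x => ?_
  obtain ⟨ψ, h1, u, t, ht⟩ := exists_local_decomposition (d := d) (n := n) (E := E) x
  have hθ : lmul ψ.1 θ = ∑ k, ∑ l, lmul (u k l) (centralForm ((t k l).comp θ)) := by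
    refine LinearMap.ext fun X => ?_
    have := ht (θ X)
    simp only [LinearMap.sum_apply]
    refine this.trans (Finset.sum_congr rfl fun k _ => Finset.sum_congr rfl fun l _ => ?_)
    exact (Subalgebra.mem_center_iff.mp (t k l (θ X)).2 (u k l)).symm
  have h2 : ψ • T θ = 0 := by
    rw [show ψ • T θ = ψ.1 * T θ from rfl, ← hT, hθ]
    simp [hT, h0]
  have h3 := congrArg (fun a : 𝒜 => a.val x) h2
  simpa [h1] using h3

/-- Central forms generate the right module of forms, locally. -/
theorem form_eq_zero_right (T : Forms 𝒵 𝒜 N →+ 𝒜) (hT : ∀ a θ, T (rmul θ a) = T θ * a)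
    (h0 : ∀ μ : Forms 𝒵 𝒵 N, T (centralForm μ) = 0) (θ : Forms 𝒵 𝒜 N) : T θ = 0 := by
  refine EndSec.ext fun x => ?_
  obtain ⟨ψ, h1, u, t, ht⟩ := exists_local_decomposition (d := d) (n := n) (E := E) x
  have hθ : rmul θ ψ.1 = ∑ k, ∑ l, rmul (centralForm ((t k l).comp θ)) (u k l) := by
    refine LinearMap.ext fun X => ?_
    have := ht (θ X)
    simp only [LinearMap.sum_apply]
    exact (Subalgebra.mem_center_iff.mp ψ.2 (θ X)).trans this
  have h2 : ψ • T θ = 0 := by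
    rw [show ψ • T θ = ψ.1 * T θ from rfl, ← Subalgebra.mem_center_iff.mp ψ.2, ← hT, hθ]
    simp [hT, h0]
  have h3 := congrArg (fun a : 𝒜 => a.val x) h2
  simpa [h1] using h3

end FormExt

/-! ### Inner derivations -/

variable (d n E) in
theorem adTraceless_injective : Function.Injective (adTraceless d n E) := by
  refine (injective_iff_map_eq_zero _).mpr fun γ hγ => Subtype.ext (EndSec.ext fun x => ?_)
  refine eq_zero_of_commute_of_trace (d := d) (n := n) (fun a => ?_) (γ.2 x)
  have h := congrArg (fun D : Der 𝒜 => (D.1 a).val x) hγ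
  exact sub_eq_zero.mp h

/-- A derivation of `Γ(End 𝓔)` which vanishes on the centre is inner. -/
theorem exists_adTraceless_eq (D : Der 𝒜) (hD : rho D = 0) : ∃ γ, adTraceless d n E γ = D := by
  choose F hF using fun x => exists_localFrame (d := d) (n := n) (E := E) x
  have hval : ∀ (G : LocalFrame d n E) (x : M) (_ : x ∈ G.V) (a : 𝒜), (D.1 a).val x =
      (G.gam D).val x * a.val x - a.val x * (G.gam D).val x := by
    intro G x hx a
    rw [G.der_val hx, hD]
    simp
  -- The local solutions `γ` agree on overlaps, since they are traceless and have the same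
  -- commutators.
  have hsm : IsSmoothEnd d n E fun x => ((F x).gam D).val x := by
    refine isSmoothEnd_of_locally_eq _ fun y => ⟨(F y).V, (F y).isOpen.mem_nhds (hF y),
      (F y).gam D, fun x hx => sub_eq_zero.mp ?_⟩
    refine eq_zero_of_commute_of_trace (d := d) (n := n) (fun a => ?_) ?_
    · rw [sub_mul, mul_sub, sub_eq_sub_iff_sub_eq_sub, ← hval _ _ (hF x), ← hval _ _ hx]
    · rw [map_sub, LocalFrame.trace_gam (hF x), LocalFrame.trace_gam hx, sub_zero]
  refine ⟨⟨EndSec.mk _ hsm, fun x => LocalFrame.trace_gam (hF x) D⟩,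
    Subtype.ext (LinearMap.ext fun a => EndSec.ext fun x => ?_)⟩
  exact (hval _ x (hF x) a).symm

/-! ### Connections with given connection on `End 𝓔` -/

theorem act_faithful {a b : 𝒜} (h : ∀ s : 𝒮, act a s = act b s) : a = b := by
  refine EndSec.ext fun x => ?_
  obtain ⟨F, hx⟩ := exists_localFrame (d := d) (n := n) (E := E) x
  refine (F.basis x hx).ext fun i => ?_
  have := congrArg (fun s : 𝒮 => s.1 x) (h (F.sec i))
  simpa only [act_val, F.sec_val x hx] using this

@[simp] theorem ptEval_vol (s : Fin n → 𝒮) (x : M) : ptEval d n E x (vol s) = volFun s x :=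
  ptEval_scalar _ (contMDiff_volFun s) x

@[simp] theorem ptEval_herm (s t : 𝒮) (x : M) : ptEval d n E x (herm s t) = hermFun s t x :=
  ptEval_scalar _ (contMDiff_hermFun s t) x

namespace LocalFrame

variable (F : LocalFrame d n E)

/-- The operator `s ↦ X s + γ s` in a local frame, where `X = ρ(D)` acts on components and
`γ = F.gam D`. -/
def localConn (D : Der 𝒜) (s : 𝒮) : 𝒮 :=
  ∑ j, act (rho D (F.coord j s)).1 (F.sec j) + act (F.gam D) s

theorem gam_add (D D' : Der 𝒜) : F.gam (D + D') = F.gam D + F.gam D' := by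
  simp [gam, add_mul, Finset.sum_add_distrib]

set_option synthInstance.maxHeartbeats 200000 in
theorem gam_smul (z : 𝒵) (D : Der 𝒜) : F.gam (z • D) = z • F.gam D := by
  refine EndSec.ext fun x => ?_
  rw [val_center_smul, gam_val, gam_val]
  have h : ∀ i j, ((z • D).1 (F.unit i j)).val x =
    ptEval d n E x z • (D.1 (F.unit i j)).val x := fun i j => val_center_smul z _ x
  simp only [h, smul_mul_assoc, ← Finset.smul_sum]
  exact smul_comm _ _ _

variable {F} {x : M} (hx : x ∈ F.V)

include hx

theorem repr_localConn (D : Der 𝒜) (s : 𝒮) (i : Fin n) :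
    (F.basis x hx).repr ((F.localConn D s).1 x) i =
      ptEval d n E x (rho D (F.coord i s)) +
        (F.basis x hx).repr ((F.gam D).val x (s.1 x)) i := by
  have h : (F.localConn D s).1 x =
      ∑ j, ptEval d n E x (rho D (F.coord j s)) • F.basis x hx j + (F.gam D).val x (s.1 x) := by
    change (∑ j, act (rho D (F.coord j s)).1 (F.sec j)).1 x + (F.gam D).val x (s.1 x) = _
    rw [Sec.sum_val]
    simp only [act_val, center_val_apply, F.sec_val x hx]
  rw [h, map_add, Finsupp.add_apply, Module.Basis.repr_sum_self]

theorem repr_mem_coord_congr (D : Der 𝒜) {z : 𝒵} {s : 𝒮} {i : Fin n}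
    (h : ∀ y (hy : y ∈ F.V), ptEval d n E y z = (F.basis y hy).repr (s.1 y) i) :
    ptEval d n E x (rho D (F.coord i s)) = ptEval d n E x (rho D z) := by
  refine vf_congr _ ?_
  filter_upwards [F.isOpen.mem_nhds hx] with y hy
  rw [F.ptEval_coord y hy, h y hy]

/-- The local operator is compatible with the derivation `D` of `Γ(End 𝓔)`. -/
theorem localConn_leibniz (D : Der 𝒜) (a : 𝒜) (s : 𝒮) : (F.localConn D (act a s)).1 x =
    (D.1 a).val x (s.1 x) + a.val x ((F.localConn D s).1 x) := by
  refine (F.basis x hx).ext_elem fun i => ?_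
  have h : ptEval d n E x (rho D (F.coord i (act a s))) =
      ptEval d n E x (rho D (∑ j, F.entry i j a * F.coord j s)) := by
    refine repr_mem_coord_congr hx D fun y hy => ?_
    rw [act_val, repr_val hy, map_sum]
    simp only [map_mul, F.ptEval_coord y hy]
  have h2 : (F.basis x hx).repr ((∑ k, ∑ l, rho D (F.entry k l a) • F.unit k l).val x (s.1 x)) i =
      ∑ j, ptEval d n E x (rho D (F.entry i j a)) * (F.basis x hx).repr (s.1 x) j := by
    simp only [EndSec.val_sum, val_center_smul, LinearMap.sum_apply, LinearMap.smul_apply,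
      F.unit_val x hx, map_sum, map_smul, Finsupp.finsetSum_apply, Finsupp.smul_apply,
      Module.Basis.repr_self, smul_eq_mul]
    rw [Finset.sum_eq_single i]
    · simp
    · intro k _ hk
      simp [hk.symm]
    · simp
  rw [repr_localConn hx, h, der_val hx, map_add, LinearMap.add_apply, map_add, Finsupp.add_apply,
    Finsupp.add_apply, h2, repr_val hx a]
  simp only [map_sum, Derivation.leibniz, map_add, smul_eq_mul, map_mul, repr_localConn hx,
    F.ptEval_coord x hx, mul_add, Finset.sum_add_distrib, LinearMap.sub_apply,
    Module.End.mul_apply, map_sub, Finsupp.sub_apply, act_val, ← repr_val hx a]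
  simp only [mul_comm]
  ring

theorem volFun_update (s : Fin n → 𝒮) (j : Fin n) (t : 𝒮) : volFun (Function.update s j t) x =
    ((Matrix.of fun i k => (F.basis x hx).repr ((s k).1 x) i).updateCol j
      fun i => (F.basis x hx).repr (t.1 x) i).det := by
  rw [F.volFun_val x hx]
  congr 1
  refine Matrix.ext fun i k => ?_
  by_cases h : k = j
  · subst h
    simp
  · simp [h]

/-- The local operator preserves the volume form, because `γ` is traceless. -/
theorem localConn_vol (D : Der 𝒜) (s : Fin n → 𝒮) : ptEval d n E x (rho D (vol s)) =
    ∑ j, volFun (Function.update s j (F.localConn D (s j))) x := by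
  set m : Matrix (Fin n) (Fin n) 𝒵 := Matrix.of fun i k => F.coord i (s k) with hm
  have hmx : ∀ y (hy : y ∈ F.V), (ptEval d n E y).mapMatrix m =
      Matrix.of fun i k => (F.basis y hy).repr ((s k).1 y) i := fun y hy =>
    Matrix.ext fun i k => F.ptEval_coord y hy i (s k)
  have h1 : ptEval d n E x (rho D (vol s)) = ptEval d n E x (rho D m.det) := by
    refine vf_congr _ ?_
    filter_upwards [F.isOpen.mem_nhds hx] with y hy
    rw [ptEval_vol, F.volFun_val y hy, AlgHom.map_det, hmx y hy]
  have h2 := sum_det_updateCol_mulVec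
    (Matrix.of fun i k => (F.basis x hx).repr ((s k).1 x) i)
    (LinearMap.toMatrix (F.basis x hx) (F.basis x hx) ((F.gam D).val x))
  rw [← LinearMap.trace_eq_matrix_trace, trace_gam hx, zero_mul] at h2
  rw [h1, derivation_det, map_sum]
  simp only [volFun_update hx, repr_localConn hx]
  have h3 : ∀ j, (fun i => ptEval d n E x (rho D (F.coord i (s j))) +
      (F.basis x hx).repr ((F.gam D).val x ((s j).1 x)) i) =
      (fun i => ptEval d n E x (rho D (F.coord i (s j)))) +
        (LinearMap.toMatrix (F.basis x hx) (F.basis x hx) ((F.gam D).val x)).mulVec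
          (fun i => (F.basis x hx).repr ((s j).1 x) i) := fun j => by
    rw [LinearMap.toMatrix_mulVec_repr]
    rfl
  simp only [h3, Matrix.det_updateCol_add, Finset.sum_add_distrib]
  simp only [Matrix.of_apply] at h2
  rw [h2, add_zero]
  refine Finset.sum_congr rfl fun j _ => ?_
  rw [AlgHom.map_det, ← hmx x hx]
  congr 1
  refine Matrix.ext fun i k => ?_
  by_cases h : k = j
  · subst h
    simp [hm]
  · simp [h]

end LocalFrame

/-- An operator on sections at a point is determined by its Leibniz rule with respect to
`Γ(End 𝓔)` and by its action on the volume form: two such operators differ by a multiple of the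
identity, and the volume form excludes it. -/
theorem eq_of_leibniz_of_vol {P P' : 𝒮 → 𝒮} {δ : 𝒜 → 𝒜} {x : M}
    (hP : ∀ a s, (P (act a s)).1 x = (δ a).val x (s.1 x) + a.val x ((P s).1 x))
    (hP' : ∀ a s, (P' (act a s)).1 x = (δ a).val x (s.1 x) + a.val x ((P' s).1 x))
    (hvol : ∀ s : Fin n → 𝒮, ∑ j, volFun (Function.update s j (P (s j))) x =
      ∑ j, volFun (Function.update s j (P' (s j))) x) (s : 𝒮) : (P s).1 x = (P' s).1 x := by
  obtain ⟨F, hx⟩ := exists_localFrame (d := d) (n := n) (E := E) x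
  obtain ⟨ψ, h1, h0⟩ := exists_bump (d := d) (n := n) (E := E) (F.isOpen.mem_nhds hx)
  set b := F.basis x hx
  let Q : 𝒮 → E x := fun s => (P s).1 x - (P' s).1 x
  have hQ : ∀ a s, Q (act a s) = a.val x (Q s) := fun a s => by
    simp only [Q, hP, hP', map_sub]
    abel
  -- `Q` commutes with `Γ(End 𝓔)`, so it is the multiplication by a number `k`: write `s` near `x`
  -- as an endomorphism applied to the first vector of the frame.
  let k : ℂ := b.repr (Q (F.sec 0)) 0
  have hk : ∀ s, Q s = k • s.1 x := by
    intro s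
    have hs : act ψ.1 s = act (ψ • ∑ i, F.coord i s • F.unit i 0) (F.sec 0) := by
      refine Sec.ext fun y => ?_
      rw [act_val, act_val, center_val_apply, val_center_smul, LinearMap.smul_apply]
      by_cases hy : y ∈ F.V
      · conv_lhs => rw [← (F.basis y hy).sum_repr (s.1 y)]
        simp [F.unit_val y hy, F.sec_val y hy, F.ptEval_coord y hy]
      · rw [h0 y hy, zero_smul, zero_smul]
    have h2 := congrArg Q hs
    rw [hQ, hQ, center_val_apply, val_center_smul, h1, one_smul, one_smul] at h2
    rw [h2]
    simp only [EndSec.val_sum, val_center_smul, LinearMap.sum_apply, LinearMap.smul_apply,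
      F.unit_val x hx, F.ptEval_coord x hx]
    conv_rhs => rw [← b.sum_repr (s.1 x), Finset.smul_sum]
    exact Finset.sum_congr rfl fun i _ => smul_comm _ _ _
  -- On the frame itself, the condition on the volume forms reads `n k = 0`.
  have hone : (Matrix.of fun i j => b.repr ((F.sec j).1 x) i) = 1 := by
    refine Matrix.ext fun i j => ?_
    rw [Matrix.of_apply, F.sec_val x hx, Module.Basis.repr_self, Matrix.one_apply,
      Finsupp.single_apply]
    simp only [eq_comm]
  have hv := hvol F.sec
  simp only [LocalFrame.volFun_update hx] at hv
  rw [show (Matrix.of fun i k => (F.basis x hx).repr ((F.sec k).1 x) i) = 1 from hone] at hv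
  simp only [← Matrix.cramer_apply, Matrix.cramer_one, Module.End.one_apply] at hv
  have hk0 : (n : ℂ) * k = 0 := by
    have h3 : ∑ j, b.repr (Q (F.sec j)) j = 0 := by
      simp only [Q, map_sub, Finsupp.sub_apply, Finset.sum_sub_distrib]
      exact sub_eq_zero.mpr hv
    rw [← h3]
    simp [hk, F.sec_val x hx, b]
  have hk1 : k = 0 := (mul_eq_zero.mp hk0).resolve_left (Nat.cast_ne_zero.mpr (NeZero.ne n))
  have := hk s
  rw [hk1, zero_smul] at this
  exact sub_eq_zero.mp this

section Connections

variable {nab : VF (EndSec d n E) →ₗ[Ctr (EndSec d n E)] Der (EndSec d n E)}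

omit [IsManifold (𝓡 d) ∞ M] [T2Space M] [IsSUBundle d n E] [NeZero n] in
theorem Connection.IsInducedOnEnd.leibniz {D : Connection d n E} (hD : D.IsInducedOnEnd nab)
    (X : VF 𝒜) (a : 𝒜) (s : 𝒮) :
    D.toFun X (act a s) = act ((nab X).1 a) s + act a (D.toFun X s) := by
  rw [hD X a s, sub_add_cancel]

theorem Connection.IsInducedOnEnd.rho_nab {D : Connection d n E} (hD : D.IsInducedOnEnd nab)
    (X : VF 𝒜) : rho (nab X) = X := by
  refine Derivation.ext fun f => Subtype.ext (act_faithful fun s => ?_)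
  have h := hD.leibniz X f.1 s
  rw [D.leibniz] at h
  exact (add_right_cancel h).symm

omit [IsManifold (𝓡 d) ∞ M] [T2Space M] [IsSUBundle d n E] [NeZero n] in
theorem Connection.IsInducedOnEnd.leibniz_val {D : Connection d n E} (hD : D.IsInducedOnEnd nab)
    (X : VF 𝒜) (x : M) (a : 𝒜) (s : 𝒮) : (D.toFun X (act a s)).1 x =
      ((nab X).1 a).val x (s.1 x) + a.val x ((D.toFun X s).1 x) := by
  rw [hD.leibniz]
  rfl

theorem Connection.PreservesVolume.ptEval {D : Connection d n E} (hv : D.PreservesVolume)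
    (X : VF 𝒜) (x : M) (s : Fin n → 𝒮) : NCG.ptEval d n E x (X (vol s)) =
      ∑ j, volFun (Function.update s j (D.toFun X (s j))) x := by
  rw [hv, map_sum]
  simp only [ptEval_vol]

/-- In a local frame, a connection preserving the volume form is determined by the connection
induced on `End 𝓔`. -/
theorem Connection.val_eq_localConn {D : Connection d n E} (hv : D.PreservesVolume)
    (hD : D.IsInducedOnEnd nab) (F : LocalFrame d n E) {x : M} (hx : x ∈ F.V) (X : VF 𝒜) (s : 𝒮) :
    (D.toFun X s).1 x = (F.localConn (nab X) s).1 x := by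
  refine eq_of_leibniz_of_vol (δ := (nab X).1) (P' := F.localConn (nab X)) (hD.leibniz_val X x)
    (LocalFrame.localConn_leibniz hx (nab X)) (fun s => ?_) s
  rw [← hv.ptEval, ← LocalFrame.localConn_vol hx, hD.rho_nab]

theorem Connection.eq_of_isInducedOnEnd {D D' : Connection d n E} (hv : D.PreservesVolume)
    (hv' : D'.PreservesVolume) (hD : D.IsInducedOnEnd nab) (hD' : D'.IsInducedOnEnd nab) :
    D = D' := by
  refine Connection.ext (funext fun X => funext fun s => Sec.ext fun x => ?_)
  obtain ⟨F, hx⟩ := exists_localFrame (d := d) (n := n) (E := E) x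
  rw [val_eq_localConn hv hD F hx, val_eq_localConn hv' hD' F hx]

set_option synthInstance.maxHeartbeats 200000 in
/-- Every lift of vector fields to derivations of `Γ(End 𝓔)` is induced by a connection on `𝓔`
which preserves the volume form. -/
theorem exists_connection (hn : ∀ X, rho (nab X) = X) :
    ∃ D : Connection d n E, D.PreservesVolume ∧ D.IsInducedOnEnd nab := by
  choose F hF using fun x => exists_localFrame (d := d) (n := n) (E := E) x
  -- The local operators glue, since on overlaps they satisfy the hypotheses of
  -- `eq_of_leibniz_of_vol`.
  have hsec : ∀ (X : VF 𝒜) (s : 𝒮),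
      (fun x => ((F x).localConn (nab X) s).1 x) ∈ Sec d n E := by
    intro X s
    refine mem_sec_of_locally_eq _ fun y => ⟨(F y).V, (F y).isOpen.mem_nhds (hF y),
      (F y).localConn (nab X) s, fun x hx => ?_⟩
    refine eq_of_leibniz_of_vol (δ := (nab X).1) (P := (F x).localConn (nab X))
      (LocalFrame.localConn_leibniz (hF x) (nab X))
      (LocalFrame.localConn_leibniz hx (nab X)) (fun s => ?_) s
    rw [← LocalFrame.localConn_vol (hF x), ← LocalFrame.localConn_vol hx]
  have hleib : ∀ (X : VF 𝒜) (a : 𝒜) (s : 𝒮) (x : M), ((F x).localConn (nab X) (act a s)).1 x =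
      ((nab X).1 a).val x (s.1 x) + a.val x (((F x).localConn (nab X) s).1 x) := fun X a s x =>
    LocalFrame.localConn_leibniz (hF x) (nab X) a s
  let D : Connection d n E :=
    { toFun := fun X s => ⟨_, hsec X s⟩
      add_field := fun X Y s => Sec.ext fun x => ((F x).basis x (hF x)).ext_elem fun i => by
        change ((F x).basis x (hF x)).repr (((F x).localConn (nab (X + Y)) s).1 x) i =
          ((F x).basis x (hF x)).repr (((F x).localConn (nab X) s).1 x +
            ((F x).localConn (nab Y) s).1 x) i
        rw [map_add nab, map_add, Finsupp.add_apply, ← map_add nab]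
        simp only [LocalFrame.repr_localConn (hF x), hn, map_add nab, LocalFrame.gam_add, map_add,
          EndSec.val_add, LinearMap.add_apply, Finsupp.add_apply, Derivation.add_apply]
        ring
      smul_field := fun f X s => Sec.ext fun x => ((F x).basis x (hF x)).ext_elem fun i => by
        change ((F x).basis x (hF x)).repr (((F x).localConn (nab (f • X)) s).1 x) i =
          ((F x).basis x (hF x)).repr (f.1.val x (((F x).localConn (nab X) s).1 x)) i
        rw [center_val_apply, map_smul ((F x).basis x (hF x)).repr, Finsupp.smul_apply]
        simp only [LocalFrame.repr_localConn (hF x), hn, LocalFrame.gam_smul, map_smul,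
          val_center_smul, LinearMap.smul_apply, Finsupp.smul_apply, Derivation.smul_apply,
          smul_eq_mul, map_mul]
        ring
      add_section := fun X s t => Sec.ext fun x => ((F x).basis x (hF x)).ext_elem fun i => by
        change ((F x).basis x (hF x)).repr (((F x).localConn (nab X) (s + t)).1 x) i =
          ((F x).basis x (hF x)).repr (((F x).localConn (nab X) s).1 x +
            ((F x).localConn (nab X) t).1 x) i
        have hst : NCG.ptEval d n E x (rho (nab X) ((F x).coord i (s + t))) =
            NCG.ptEval d n E x (rho (nab X) ((F x).coord i s + (F x).coord i t)) :=
          LocalFrame.repr_mem_coord_congr (hF x) _ fun y hy => by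
            rw [map_add, (F x).ptEval_coord y hy, (F x).ptEval_coord y hy, ← Finsupp.add_apply,
              ← map_add]
            rfl
        have hadd : (s + t).1 x = s.1 x + t.1 x := rfl
        rw [map_add, Finsupp.add_apply]
        simp only [LocalFrame.repr_localConn (hF x), hst, hadd, map_add, Finsupp.add_apply]
        ring
      leibniz := fun X f s => Sec.ext fun x => by
        refine (hleib X f.1 s x).trans ?_
        rw [← rho_apply_val, hn]
        rfl }
  refine ⟨D, fun X s => center_ext fun x => ?_, fun X a s => Sec.ext fun x => ?_⟩
  · have h := LocalFrame.localConn_vol (hF x) (nab X) s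
    rw [hn] at h
    rw [h, map_sum]
    refine Finset.sum_congr rfl fun j _ => ?_
    rw [ptEval_vol, LocalFrame.volFun_update (hF x), LocalFrame.volFun_update (hF x)]
  · exact eq_sub_of_add_eq (hleib X a s x).symm

end Connections

set_option synthInstance.maxHeartbeats 200000

/-! ### Evaluations and orthogonality on central forms -/

section LocalForms

variable {N : Type*} [AddCommGroup N] [Module (Ctr (EndSec d n E)) N]

/-- A left combination of evaluations which takes central values on central forms agrees on them
with one evaluation: replace the coefficients by their normalized traces. -/
theorem exists_eval_of_mem_span {ψ : Forms 𝒵 𝒜 N → 𝒜}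
    (hψ : ψ ∈ Submodule.span 𝒜 (Set.range fun (X : N) (η : Forms 𝒵 𝒜 N) => η X))
    (hc : ∀ μ : Forms 𝒵 𝒵 N, ψ (centralForm μ) ∈ Subalgebra.center ℂ 𝒜) :
    ∃ X : N, ∀ μ : Forms 𝒵 𝒵 N, ψ (centralForm μ) = (μ X).1 := by
  have key : ∀ b : 𝒜, ∃ X : N, ∀ μ : Forms 𝒵 𝒵 N,
      tr d n E (b * ψ (centralForm μ)) = μ X := by
    clear hc
    induction hψ using Submodule.span_induction with
    | mem ψ hψ =>
      obtain ⟨X, rfl⟩ := hψ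
      refine fun b => ⟨tr d n E b • X, fun μ => ?_⟩
      change tr d n E (b * (μ X).1) = _
      have hz : b * (μ X).1 = μ X • b := Subalgebra.mem_center_iff.mp (μ X).2 b
      rw [hz, map_smul, map_smul, smul_eq_mul, smul_eq_mul, mul_comm]
    | zero => exact fun b => ⟨0, fun μ => by simp⟩
    | add ψ ψ' _ _ hψ hψ' =>
      intro b
      obtain ⟨X, hX⟩ := hψ b
      obtain ⟨X', hX'⟩ := hψ' b
      exact ⟨X + X', fun μ => by rw [Pi.add_apply, mul_add, map_add, hX, hX', map_add]⟩
    | smul c ψ _ hψ =>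
      intro b
      obtain ⟨X, hX⟩ := hψ (b * c)
      exact ⟨X, fun μ => by rw [Pi.smul_apply, smul_eq_mul, ← mul_assoc, hX]⟩
  obtain ⟨X, hX⟩ := key ((n : ℂ)⁻¹ • 1)
  refine ⟨X, fun μ => ?_⟩
  have hz : (⟨ψ (centralForm μ), hc μ⟩ : 𝒵) = μ X := by
    rw [← hX]
    refine center_ext fun x => ?_
    rw [ptEval_tr, smul_mul_assoc, one_mul, EndSec.val_csmul, map_smul]
    rfl
  exact congrArg Subtype.val hz

/-- For a nondegenerate `h` and a central form `μ`, `h(μ, ·)` is the evaluation at an element. -/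
theorem BimoduleForm.IsNondegenerate.exists_eval {h : BimoduleForm 𝒵 𝒜 N}
    (hh : h.IsNondegenerate) (μ : Forms 𝒵 𝒵 N) :
    ∃ X : N, ∀ η, h.toFun (centralForm μ) η = η X := by
  obtain ⟨X, hX⟩ := exists_eval_of_mem_span (hh.2.subset ⟨centralForm μ, rfl⟩)
    (h.central_mem μ)
  refine ⟨X, fun η => sub_eq_zero.mp ?_⟩
  -- Both sides are left linear in `η`, because `μ` is central, and they agree on central forms.
  refine form_eq_zero_left
    (h.rightHom (centralForm μ) - AddMonoidHom.mk' (fun η => η X) fun _ _ => rfl)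
    (fun a η => ?_) (fun ν => ?_) η
  · change h.toFun (centralForm μ) (lmul a η) - a * η X =
      a * (h.toFun (centralForm μ) η - η X)
    rw [← h.balanced, rmul_centralForm, h.lmul_left, mul_sub]
  · exact sub_eq_zero.mpr (hX ν)

section Splitting

variable {N₁ N₂ : Type*} [AddCommGroup N₁] [Module (Ctr (EndSec d n E)) N₁]
  [AddCommGroup N₂] [Module (Ctr (EndSec d n E)) N₂]
  {h : BimoduleForm (Ctr (EndSec d n E)) (EndSec d n E) N}

theorem BimoduleForm.pullback_eq_zero_left {φ : N →ₗ[𝒵] N₁} {θ : Forms 𝒵 𝒜 N}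
    (h0 : ∀ μ : Forms 𝒵 𝒵 N₁, h.toFun (pullback φ (centralForm μ)) θ = 0) (μ : Forms 𝒵 𝒜 N₁) :
    h.toFun (pullback φ μ) θ = 0 :=
  form_eq_zero_left ((h.leftHom θ).comp (BimoduleForm.pullbackHom φ))
    (fun a μ => h.lmul_left a (pullback φ μ) θ) h0 μ

theorem BimoduleForm.pullback_eq_zero_right {φ : N →ₗ[𝒵] N₁} {θ : Forms 𝒵 𝒜 N}
    (h0 : ∀ μ : Forms 𝒵 𝒵 N₁, h.toFun θ (pullback φ (centralForm μ)) = 0) (μ : Forms 𝒵 𝒜 N₁) :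
    h.toFun θ (pullback φ μ) = 0 :=
  form_eq_zero_right ((h.rightHom θ).comp (BimoduleForm.pullbackHom φ))
    (fun a μ => h.rmul_right θ (pullback φ μ) a) h0 μ

/-- Orthogonality of two submodules of forms is symmetric; by locality it is enough to consider
central forms, for which `h` is symmetric. -/
theorem BimoduleForm.IsSymmetric.orthogonal_swap (hs : h.IsSymmetric) {φ₁ : N →ₗ[𝒵] N₁}
    {φ₂ : N →ₗ[𝒵] N₂} (h12 : ∀ μ η, h.toFun (pullback φ₁ μ) (pullback φ₂ η) = 0)
    (η : Forms 𝒵 𝒜 N₂) (μ : Forms 𝒵 𝒜 N₁) :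
    h.toFun (pullback φ₂ η) (pullback φ₁ μ) = 0 :=
  BimoduleForm.pullback_eq_zero_left (fun η => BimoduleForm.pullback_eq_zero_right (fun μ =>
    (hs _ _ (isCentralForm_pullback φ₂ η) (isCentralForm_pullback φ₁ μ)).trans
        (h12 (centralForm μ) (centralForm η))) μ) η

end Splitting

end LocalForms

/-! ### The connection determined by a metric -/

section Lifts

variable {h : DerBimoduleForm d n E}

theorem exists_isHorizontalLift (hh : h.IsNondegenerate)
    (hM : (baseMetric h).IsNondegenerate) (X : VF 𝒜) :
    ∃ D, IsHorizontalLift h X D := by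
  have hX : (fun ν : Forms 𝒵 𝒵 (VF 𝒜) => ν X) ∈ Set.range (baseMetric h).toFun := by
    rw [hM.2]
    exact Submodule.subset_span ⟨X, rfl⟩
  obtain ⟨μ, hμ⟩ := hX
  obtain ⟨D, hD⟩ := hh.exists_eval (pullback rho μ)
  exact ⟨D, μ, congrFun hμ, hD⟩

variable {nab : VF (EndSec d n E) →ₗ[Ctr (EndSec d n E)] Der (EndSec d n E)}
  {α : Der (EndSec d n E) →ₗ[Ctr (EndSec d n E)] Traceless d n E}

omit [NeZero n] in
/-- The defining equation of the connection form, without a subtraction. -/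
theorem isConnectionForm_iff :
    IsConnectionForm nab α ↔ ∀ D, D + adTraceless d n E (α D) = nab (rho D) := by
  refine forall_congr' fun D => ?_
  rw [← Subtype.coe_inj, ← Subtype.coe_inj]
  exact eq_sub_iff_add_eq

/-- Two derivations with the same restriction to the centre differ by an inner derivation. -/
theorem exists_add_adTraceless_eq (D D' : Der 𝒜) (hD : rho D = rho D') :
    ∃ γ, D + adTraceless d n E γ = D' := by
  obtain ⟨γ, hγ⟩ := exists_adTraceless_eq (d := d) (n := n) (E := E) ⟨D'.1 - D.1, fun a b => by
    simp only [LinearMap.sub_apply, D'.2 a b, D.2 a b, mul_sub, sub_mul]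
    abel⟩ (Derivation.ext fun f => Subtype.ext (sub_eq_zero.mpr
      (congrArg Subtype.val (Derivation.congr_fun hD f)).symm))
  refine ⟨γ, Subtype.ext ?_⟩
  rw [hγ]
  exact add_sub_cancel D.1 D'.1

theorem exists_isConnectionForm (hn : ∀ X, rho (nab X) = X) :
    ∃ α : Der 𝒜 →ₗ[𝒵] Traceless d n E, IsConnectionForm nab α := by
  obtain ⟨α, hα⟩ := exists_connectionForm (A := EndSec d n E) (σ := adTraceless d n E)
    (adTraceless_injective d n E) exists_add_adTraceless_eq hn
  exact ⟨α, isConnectionForm_iff.mpr hα⟩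

omit [NeZero n] in
theorem rho_adTraceless (γ : Traceless d n E) : rho (adTraceless d n E γ) = 0 :=
  Derivation.ext fun f => Subtype.ext
    (sub_eq_zero.mpr (Subalgebra.mem_center_iff.mp f.2 γ.1))

/-- The connection given by the horizontal lift makes tensorial and interior forms orthogonal. -/
theorem isOrthogonal_of_isHorizontalLift (hh : h.IsNondegenerate)
    (hM : (baseMetric h).IsNondegenerate)
    (hnab : ∀ X, IsHorizontalLift h X (nab X)) (hα : IsConnectionForm nab α) :
    IsOrthogonal h α := by
  intro μ η
  refine BimoduleForm.pullback_eq_zero_left (fun μ => ?_) μ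
  obtain ⟨D, hD⟩ := hh.exists_eval (pullback rho μ)
  have hl : D = nab (rho D) := (isHorizontalLift_of_eval hD).unique hM (hnab _)
  refine (hD (pullback α η)).trans ?_
  have h0 : α D = 0 := by
    rw [hl]
    exact connectionForm_lift (A := EndSec d n E) (isConnectionForm_iff.mp hα)
      (adTraceless_injective d n E) (fun X => (hnab X).rho_eq) (rho D)
  exact (congrArg η h0).trans (map_zero η)

omit [NeZero n] in
theorem IsOrthogonal.eq_of_isHorizontalLift (ho : IsOrthogonal h α) (hα : IsConnectionForm nab α)
    {X : VF 𝒜} {D : Der 𝒜} (hD : IsHorizontalLift h X D) : nab X = D :=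
  NCG.eq_of_isHorizontalLift (A := EndSec d n E) (isConnectionForm_iff.mp hα)
    (ι := (Traceless d n E).subtype) Subtype.val_injective ho hD

theorem IsOrthogonal.swap (ho : IsOrthogonal h α) (hs : h.IsSymmetric)
    (η : Forms 𝒵 𝒜 (Traceless d n E)) (μ : Forms 𝒵 𝒜 (VF 𝒜)) :
    h.toFun (pullback α η) (pullback rho μ) = 0 :=
  BimoduleForm.IsSymmetric.orthogonal_swap hs ho η μ

theorem IsOrthogonal.metric_splitting (ho : IsOrthogonal h α) (hh : h.IsMetric)
    (hα : IsConnectionForm nab α) (hn : ∀ X, rho (nab X) = X) :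
    (∀ θ η, h.toFun θ η = ((h.push rho).push nab).toFun θ η +
        ((h.push α).push (adTraceless d n E)).toFun θ η) ∧
      (h.push rho).IsMetric ∧ (h.push α).IsMetric :=
  NCG.metric_splitting (A := EndSec d n E) hh (isConnectionForm_iff.mp hα) ho (ho.swap hh.1) hn
    (connectionForm_inner (A := EndSec d n E) (isConnectionForm_iff.mp hα)
      (adTraceless_injective d n E) rho_adTraceless)

end Lifts

/-! ### Complex conjugation and adjoints -/

theorem contMDiff_star_ptEval (f : 𝒵) :
    ContMDiff (𝓡 d) 𝓘(ℝ, ℂ) ∞ (fun x => star (ptEval d n E x f)) :=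
  Complex.conjCLE.contDiff.contMDiff.comp (contMDiff_ptEval f)

/-- Complex conjugation of smooth functions. -/
def conjC (f : 𝒵) : 𝒵 := scalar E _ (contMDiff_star_ptEval f)

@[simp] theorem ptEval_conjC (f : 𝒵) (x : M) :
    ptEval d n E x (conjC f) = star (ptEval d n E x f) :=
  ptEval_scalar _ (contMDiff_star_ptEval f) x

@[simp] theorem conjC_conjC (f : 𝒵) : conjC (conjC f) = f := center_ext fun x => by simp

theorem conjC_add (f g : 𝒵) : conjC (f + g) = conjC f + conjC g := center_ext fun x => by simp

theorem conjC_mul (f g : 𝒵) : conjC (f * g) = conjC f * conjC g := center_ext fun x => by simp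

/-- Adjoints can be tested pointwise. -/
theorem isAdj_iff {a b : 𝒜} :
    IsAdj a b ↔ ∀ (s t : 𝒮) (x : M), hermFun (act a s) t x = hermFun s (act b t) x := by
  refine forall_congr' fun s => forall_congr' fun t => ⟨fun h x => ?_, fun h => ?_⟩
  · have := congrArg (ptEval d n E x) h
    rwa [ptEval_herm, ptEval_herm] at this
  · refine center_ext fun x => ?_
    rw [ptEval_herm, ptEval_herm, h]

omit [IsManifold (𝓡 d) ∞ M] [T2Space M] [IsSUBundle d n E] [NeZero n] in
theorem hermFun_conj (s t : 𝒮) (x : M) : star (hermFun s t x) = hermFun t s x :=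
  inner_conj_symm _ _

theorem IsAdj.symm {a b : 𝒜} (h : IsAdj a b) : IsAdj b a :=
  isAdj_iff.mpr fun s t x => by
    rw [← hermFun_conj t, ← isAdj_iff.mp h, hermFun_conj]

theorem IsAdj.entry {a b : 𝒜} (h : IsAdj a b) {F : LocalFrame d n E} {x : M} (hx : x ∈ F.V)
    (i j : Fin n) :
    ptEval d n E x (F.entry i j b) = star (ptEval d n E x (F.entry j i a)) := by
  have h1 := isAdj_iff.mp h (F.sec i) (F.sec j) x
  rw [F.hermFun_val x hx, F.hermFun_val x hx] at h1
  simp only [act_val, F.sec_val x hx, Module.Basis.repr_self, Finsupp.single_apply] at h1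
  rw [LocalFrame.ptEval_entry hx, LocalFrame.ptEval_entry hx]
  simpa [apply_ite (star : ℂ → ℂ)] using h1.symm

/-- Adjoints can be tested on matrix entries in local unitary frames. -/
theorem isAdj_of_entry {a b : 𝒜} (h : ∀ x, ∃ F : LocalFrame d n E, x ∈ F.V ∧ ∀ i j,
    ptEval d n E x (F.entry i j b) = star (ptEval d n E x (F.entry j i a))) : IsAdj a b := by
  refine isAdj_iff.mpr fun s t x => ?_
  obtain ⟨F, hx, hF⟩ := h x
  rw [F.hermFun_val x hx, F.hermFun_val x hx]
  simp only [act_val, LocalFrame.repr_val hx, hF, Finset.mul_sum, Finset.sum_mul, star_sum,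
    star_mul']
  rw [Finset.sum_comm]
  exact Finset.sum_congr rfl fun i _ => Finset.sum_congr rfl fun j _ => by ring

theorem isAdj_center_iff {f g : 𝒵} : IsAdj f.1 g.1 ↔ g = conjC f := by
  have hent : ∀ (z : 𝒵) (F : LocalFrame d n E) (x : M) (_ : x ∈ F.V) (i j : Fin n),
      ptEval d n E x (F.entry i j z.1) = if i = j then ptEval d n E x z else 0 := by
    intro z F x hx i j
    rw [LocalFrame.ptEval_entry hx, center_val_apply, map_smul, Module.Basis.repr_self,
      Finsupp.smul_apply, Finsupp.single_apply, smul_eq_mul, mul_ite, mul_one, mul_zero]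
    simp only [eq_comm]
  constructor
  · intro h
    refine center_ext fun x => ?_
    obtain ⟨F, hx⟩ := exists_localFrame (d := d) (n := n) (E := E) x
    have h1 := h.entry hx 0 0
    rwa [hent _ _ _ hx, hent _ _ _ hx, if_pos rfl, if_pos rfl, ← ptEval_conjC] at h1
  · rintro rfl
    refine isAdj_of_entry fun x => ?_
    obtain ⟨F, hx⟩ := exists_localFrame (d := d) (n := n) (E := E) x
    refine ⟨F, hx, fun i j => ?_⟩
    rw [hent _ _ _ hx, hent _ _ _ hx, ptEval_conjC]
    by_cases hij : i = j
    · simp [hij]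
    · simp [hij, Ne.symm hij]

/-- Near a point, the matrix units of a local unitary frame agree with global sections which are
adjoint to each other. -/
theorem LocalFrame.exists_isAdj_unit (F : LocalFrame d n E) {x : M} (hx : x ∈ F.V) (i j : Fin n) :
    ∃ u v : 𝒜, IsAdj u v ∧ (∀ᶠ y in nhds x, u.val y = (F.unit i j).val y) ∧
      ∀ᶠ y in nhds x, v.val y = (F.unit j i).val y := by
  obtain ⟨ψ, h1, h0, hr⟩ := exists_real_bump (d := d) (n := n) (E := E) (F.isOpen.mem_nhds hx)
  refine ⟨ψ • F.unit i j, ψ • F.unit j i, isAdj_iff.mpr fun s t y => ?_, ?_, ?_⟩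
  · by_cases hy : y ∈ F.V
    · rw [F.hermFun_val y hy, F.hermFun_val y hy]
      simp only [act_val, val_center_smul, LinearMap.smul_apply, F.unit_val y hy, map_smul,
        Finsupp.smul_apply, Module.Basis.repr_self, Finsupp.single_apply, smul_eq_mul, mul_ite,
        mul_one, mul_zero, apply_ite (star : ℂ → ℂ), star_zero, ite_mul, zero_mul, star_mul', hr,
        Finset.sum_ite_eq, Finset.mem_univ, if_true]
      ring
    · simp [hermFun, h0 y hy]
  · filter_upwards [h1] with y hy
    rw [val_center_smul, hy, one_smul]
  · filter_upwards [h1] with y hy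
    rw [val_center_smul, hy, one_smul]

theorem conjC_tr_mul {a b c e : 𝒜} (hab : IsAdj a b) (hce : IsAdj c e) :
    conjC (tr d n E (a * c)) = tr d n E (b * e) := by
  refine center_ext fun x => ?_
  obtain ⟨F, hx⟩ := exists_localFrame (d := d) (n := n) (E := E) x
  have htr : ∀ a c : 𝒜, ptEval d n E x (tr d n E (a * c)) =
      ∑ i, ∑ j, ptEval d n E x (F.entry i j a) * ptEval d n E x (F.entry j i c) := by
    intro a c
    rw [ptEval_tr, LinearMap.trace_eq_matrix_trace ℂ (F.basis x hx), Matrix.trace]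
    refine Finset.sum_congr rfl fun i _ => ?_
    rw [Matrix.diag_apply, LinearMap.toMatrix_apply, EndSec.val_mul, Module.End.mul_apply,
      LocalFrame.repr_val hx]
    simp only [LocalFrame.ptEval_entry hx]
  rw [ptEval_conjC, htr, htr, Finset.sum_comm]
  simp only [star_sum, star_mul', hab.entry hx, hce.entry hx]

/-! ### Real vector fields and real one-forms -/

/-- The complex conjugate of a vector field. -/
def conjVF (X : VF 𝒜) : VF 𝒜 :=
  Derivation.mk'
    { toFun := fun f => conjC (X (conjC f))
      map_add' := fun f g => by rw [conjC_add, map_add, conjC_add]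
      map_smul' := fun c f => by
        have h : conjC (c • f) = star c • conjC f := center_ext fun x => by simp
        have h' : ∀ g : 𝒵, conjC (star c • g) = c • conjC g := fun g => center_ext fun x => by simp
        rw [h, Derivation.map_smul, h', RingHom.id_apply] }
    (fun f g => by
      change conjC (X (conjC (f * g))) = f * conjC (X (conjC g)) + g * conjC (X (conjC f))
      rw [conjC_mul, Derivation.leibniz, smul_eq_mul, smul_eq_mul, conjC_add, conjC_mul, conjC_mul,
        conjC_conjC, conjC_conjC])

theorem conjVF_apply (X : VF 𝒜) (f : 𝒵) : conjVF X f = conjC (X (conjC f)) := rfl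

theorem conjVF_conjVF (X : VF 𝒜) : conjVF (conjVF X) = X :=
  Derivation.ext fun f => by rw [conjVF_apply, conjVF_apply, conjC_conjC, conjC_conjC]

theorem IsRealField.conjC_apply {X : VF 𝒜} (hX : IsRealField X) (f : 𝒵) :
    X (conjC f) = conjC (X f) :=
  isAdj_center_iff.mp (hX f (conjC f) (isAdj_center_iff.mpr rfl))

theorem IsRealField.conjVF_eq {X : VF 𝒜} (hX : IsRealField X) : conjVF X = X :=
  Derivation.ext fun f => by rw [conjVF_apply, hX.conjC_apply, conjC_conjC]

omit [IsManifold (𝓡 d) ∞ M] [T2Space M] [NeZero n] in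
theorem IsRealDer.isRealField {D : Der 𝒜} (hD : IsRealDer D) : IsRealField (rho D) :=
  fun f g hfg => hD f.1 g.1 hfg

/-- The complex conjugate of a one-form on `M`. -/
def conjForm (μ : Forms 𝒵 𝒵 (VF 𝒜)) : Forms 𝒵 𝒵 (VF 𝒜) where
  toFun X := conjC (μ (conjVF X))
  map_add' X Y := by
    have h : conjVF (X + Y) = conjVF X + conjVF Y := Derivation.ext fun f => conjC_add _ _
    rw [h, map_add, conjC_add]
  map_smul' z X := by
    have h : conjVF (z • X) = conjC z • conjVF X := Derivation.ext fun f => conjC_mul _ _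
    rw [h, map_smul, smul_eq_mul, conjC_mul, conjC_conjC, RingHom.id_apply, smul_eq_mul]

theorem conjForm_apply (μ : Forms 𝒵 𝒵 (VF 𝒜)) (X : VF 𝒜) :
    conjForm μ X = conjC (μ (conjVF X)) := rfl

theorem conjC_apply_of_conjForm_eq {μ : Forms 𝒵 𝒵 (VF 𝒜)} (hμ : conjForm μ = μ) {X : VF 𝒜}
    (hX : IsRealField X) : conjC (μ X) = μ X := by
  conv_rhs => rw [← hμ, conjForm_apply, hX.conjVF_eq]

theorem isRealForm_of_conjForm_eq {μ : Forms 𝒵 𝒵 (VF 𝒜)} (hμ : conjForm μ = μ) :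
    IsRealForm (d := d) (n := n) (E := E) (basicForm μ) := fun _ hD =>
  isAdj_center_iff.mpr (conjC_apply_of_conjForm_eq hμ hD.isRealField).symm

theorem ptEval_const_lmul (c : ℂ) (ν : Forms 𝒵 𝒵 (VF 𝒜)) (X : VF 𝒜) (x : M) :
    ptEval d n E x (lmul (algebraMap ℂ 𝒵 c) ν X) = c * ptEval d n E x (ν X) := by
  change ptEval d n E x (algebraMap ℂ 𝒵 c * ν X) = _
  rw [map_mul, AlgHom.commutes]
  rfl

theorem ptEval_conjForm (ν : Forms 𝒵 𝒵 (VF 𝒜)) (X : VF 𝒜) (x : M) :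
    ptEval d n E x (conjForm ν X) = star (ptEval d n E x (ν (conjVF X))) :=
  ptEval_conjC _ x

/-- Decomposition of a one-form on `M` into its real and imaginary part. -/
theorem exists_real_imag (ν : Forms 𝒵 𝒵 (VF 𝒜)) :
    ∃ p q : Forms 𝒵 𝒵 (VF 𝒜), conjForm p = p ∧ conjForm q = q ∧
      ν = p + lmul (algebraMap ℂ 𝒵 Complex.I) q := by
  refine ⟨lmul (algebraMap ℂ 𝒵 (1 / 2)) (ν + conjForm ν),
    lmul (algebraMap ℂ 𝒵 (-Complex.I / 2)) (ν - conjForm ν), ?_, ?_, ?_⟩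
  · refine LinearMap.ext fun X => center_ext fun x => ?_
    rw [ptEval_conjForm, ptEval_const_lmul, ptEval_const_lmul, LinearMap.add_apply,
      LinearMap.add_apply, map_add, map_add, ptEval_conjForm, ptEval_conjForm, conjVF_conjVF,
      star_mul', star_add, star_star, add_comm]
    simp
  · refine LinearMap.ext fun X => center_ext fun x => ?_
    rw [ptEval_conjForm, ptEval_const_lmul, ptEval_const_lmul, LinearMap.sub_apply,
      LinearMap.sub_apply, map_sub, map_sub, ptEval_conjForm, ptEval_conjForm, conjVF_conjVF,
      star_mul', star_sub, star_star, show star (-Complex.I / 2) = Complex.I / 2 by simp]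
    ring
  · refine LinearMap.ext fun X => center_ext fun x => ?_
    rw [LinearMap.add_apply, map_add, ptEval_const_lmul, ptEval_const_lmul, ptEval_const_lmul,
      LinearMap.sub_apply, LinearMap.add_apply, map_sub, map_add]
    linear_combination ((1 / 2 : ℂ) * (ptEval d n E x (ν X) - ptEval d n E x (conjForm ν X))) *
      Complex.I_sq

/-! ### Real metrics and real derivations -/

section RealMetric

variable {h : DerBimoduleForm d n E}

/-- A real metric induces a real metric on the one-forms on `M`. -/
theorem BimoduleForm.IsReal.conjC_baseMetric (hr : h.IsReal) {μ ν : Forms 𝒵 𝒵 (VF 𝒜)}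
    (hμ : conjForm μ = μ) (hν : conjForm ν = ν) :
    conjC ((baseMetric h).toFun μ ν) = (baseMetric h).toFun μ ν := by
  have h1 := hr (basicForm μ) (basicForm ν) (isCentralForm_basicForm μ) (isCentralForm_basicForm ν)
    (isRealForm_of_conjForm_eq hμ) (isRealForm_of_conjForm_eq hν)
  rw [← baseMetric_val] at h1
  exact (isAdj_center_iff.mp h1).symm

/-- For a real metric on `M`, the one-form dual to a real vector field is real. -/
theorem conjForm_eq_of_dual {g : BimoduleForm (Ctr (EndSec d n E)) (Ctr (EndSec d n E))
      (VF (EndSec d n E))} (hg : g.IsNondegenerate)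
    (hr : ∀ μ ν, conjForm μ = μ → conjForm ν = ν → conjC (g.toFun μ ν) = g.toFun μ ν)
    {X : VF 𝒜} (hX : IsRealField X) {μ : Forms 𝒵 𝒵 (VF 𝒜)} (hμ : ∀ ν, g.toFun μ ν = ν X) :
    conjForm μ = μ := by
  obtain ⟨p, q, hp, hq, hpq⟩ := exists_real_imag μ
  -- For real `ν`, the imaginary part of the real function `g(μ, ν) = ν(X)` is `g(q, ν)`.
  have h1 : ∀ ν, conjForm ν = ν → g.toFun q ν = 0 := by
    intro ν hν
    have e1 := hμ ν
    rw [hpq, g.add_left, g.lmul_left] at e1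
    have e2 := hr p ν hp hν
    have e3 := hr q ν hq hν
    have e4 := conjC_apply_of_conjForm_eq hν hX
    refine center_ext fun x => ?_
    have f1 := congrArg (ptEval d n E x) e1
    have f2 := congrArg (ptEval d n E x) e2
    have f3 := congrArg (ptEval d n E x) e3
    have f4 := congrArg (ptEval d n E x) e4
    rw [ptEval_conjC] at f2 f3 f4
    rw [map_add, map_mul, AlgHom.commutes, Algebra.algebraMap_self, RingHom.id_apply] at f1
    rw [← f1, star_add, star_mul', f2, f3, Complex.star_def, Complex.conj_I] at f4
    have f5 : (2 * Complex.I) * ptEval d n E x (g.toFun q ν) = 0 := by linear_combination -f4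
    rw [map_zero]
    exact (mul_eq_zero.mp f5).resolve_left (by simp)
  have h2 : q = 0 := by
    refine hg.1 (funext fun ν => ?_)
    obtain ⟨ν₁, ν₂, hν₁, hν₂, rfl⟩ := exists_real_imag ν
    rw [g.add_right, g.lmul_right, h1 _ hν₁, h1 _ hν₂, mul_zero, add_zero]
    exact (map_zero (g.leftHom _)).symm
  have h3 : lmul (algebraMap ℂ 𝒵 Complex.I) q = 0 := by
    rw [h2]
    exact LinearMap.comp_zero _
  rw [hpq, h3, add_zero, hp]

variable (d n E) in
/-- The central form `D ↦ tr(c D(a))`. -/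
def traceForm (c a : 𝒜) : Forms 𝒵 𝒵 (Der 𝒜) where
  toFun D := tr d n E (c * D.1 a)
  map_add' D D' := by
    change tr d n E (c * (D.1 a + D'.1 a)) = _
    rw [mul_add, map_add]
  map_smul' z D := by
    change tr d n E (c * (z • D.1 a)) = z • tr d n E (c * D.1 a)
    rw [mul_smul_comm, map_smul]

theorem isCentralForm_traceForm (c a : 𝒜) : IsCentralForm (centralForm (traceForm d n E c a)) :=
  isCentralForm_centralForm (A := EndSec d n E) (traceForm d n E c a)

theorem isRealForm_traceForm {c a : 𝒜} (hc : IsAdj c c) (ha : IsAdj a a) :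
    IsRealForm (centralForm (traceForm d n E c a)) := fun _ hD =>
  isAdj_center_iff.mpr (conjC_tr_mul hc (hD a a ha)).symm

/-- For a real metric, the horizontal lift `D` of a real vector field is such that `tr(c D(a))` is
real for all Hermitian `c` and `a`: this is the product of two real forms. -/
theorem IsHorizontalLift.conjC_tr (hr : h.IsReal)
    (hM : (baseMetric h).IsNondegenerate) {X : VF 𝒜} (hX : IsRealField X) {D : Der 𝒜}
    (hD : IsHorizontalLift h X D) {c a : 𝒜} (hc : IsAdj c c) (ha : IsAdj a a) :
    conjC (tr d n E (c * D.1 a)) = tr d n E (c * D.1 a) := by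
  obtain ⟨μ, h1, h2⟩ := hD
  have h3 := hr (basicForm μ) (centralForm (traceForm d n E c a))
    (isCentralForm_basicForm μ) (isCentralForm_traceForm c a)
    (isRealForm_of_conjForm_eq
      (conjForm_eq_of_dual hM (fun _ _ => hr.conjC_baseMetric) hX h1)) (isRealForm_traceForm hc ha)
  rw [h2] at h3
  exact ((isAdj_center_iff (f := tr d n E (c * D.1 a)) (g := tr d n E (c * D.1 a))).mp h3).symm

end RealMetric

theorem IsAdj.add {a b a' b' : 𝒜} (hab : IsAdj a b) (hab' : IsAdj a' b') :
    IsAdj (a + a') (b + b') := by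
  refine isAdj_of_entry fun x => ?_
  obtain ⟨F, hx⟩ := exists_localFrame (d := d) (n := n) (E := E) x
  refine ⟨F, hx, fun i j => ?_⟩
  rw [map_add, map_add, hab.entry hx, hab'.entry hx, map_add, map_add, star_add]

theorem IsAdj.const_smul (c : ℂ) {a b : 𝒜} (hab : IsAdj a b) : IsAdj (c • a) (star c • b) := by
  refine isAdj_of_entry fun x => ?_
  obtain ⟨F, hx⟩ := exists_localFrame (d := d) (n := n) (E := E) x
  refine ⟨F, hx, fun i j => ?_⟩
  have hc : ∀ (c : ℂ) (a : 𝒜) (i j : Fin n), ptEval d n E x (F.entry i j (c • a)) =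
      c * ptEval d n E x (F.entry i j a) := fun c a i j => by
    rw [LocalFrame.ptEval_entry hx, LocalFrame.ptEval_entry hx, EndSec.val_csmul,
      LinearMap.smul_apply, map_smul, Finsupp.smul_apply, smul_eq_mul]
  rw [hc, hc, hab.entry hx, star_mul']

/-- Twice the real part of `a` is Hermitian. -/
theorem IsAdj.add_self {a b : 𝒜} (hab : IsAdj a b) : IsAdj (a + b) (a + b) := by
  have h := hab.add hab.symm
  rwa [add_comm b a] at h

/-- Twice the imaginary part of `a`, up to sign, is Hermitian. -/
theorem IsAdj.I_smul_add_self {a b : 𝒜} (hab : IsAdj a b) :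
    IsAdj (Complex.I • a + (-Complex.I) • b) (Complex.I • a + (-Complex.I) • b) := by
  have h := (hab.const_smul Complex.I).add (hab.symm.const_smul (-Complex.I))
  rwa [star_neg, Complex.star_def, Complex.conj_I, neg_neg, add_comm (_ • b)] at h

theorem ptEval_tr_csmul (c : ℂ) (w : 𝒜) (x : M) :
    ptEval d n E x (tr d n E (c • w)) = c * ptEval d n E x (tr d n E w) := by
  rw [ptEval_tr, ptEval_tr, EndSec.val_csmul, map_smul, smul_eq_mul]

/-- An endomorphism is Hermitian if its traces against all Hermitian endomorphisms are real: test
against the Hermitian parts of the matrix units. -/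
theorem isAdj_of_conjC_tr {b : 𝒜}
    (h : ∀ c : 𝒜, IsAdj c c → conjC (tr d n E (c * b)) = tr d n E (c * b)) : IsAdj b b := by
  refine isAdj_of_entry fun x => ?_
  obtain ⟨F, hx⟩ := exists_localFrame (d := d) (n := n) (E := E) x
  refine ⟨F, hx, fun i j => ?_⟩
  obtain ⟨u, v, huv, hu, hv⟩ := F.exists_isAdj_unit hx j i
  have f1 := congrArg (ptEval d n E x) (h _ huv.add_self)
  have f2 := congrArg (ptEval d n E x) (h _ huv.I_smul_add_self)
  have hu' : ptEval d n E x (tr d n E (u * b)) = ptEval d n E x (F.entry i j b) := by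
    rw [ptEval_tr, EndSec.val_mul, hu.self_of_nhds]
    exact (ptEval_tr (F.unit j i * b) x).symm
  have hv' : ptEval d n E x (tr d n E (v * b)) = ptEval d n E x (F.entry j i b) := by
    rw [ptEval_tr, EndSec.val_mul, hv.self_of_nhds]
    exact (ptEval_tr (F.unit i j * b) x).symm
  rw [ptEval_conjC, add_mul, map_add, map_add, hu', hv', star_add] at f1
  rw [ptEval_conjC, add_mul, smul_mul_assoc, smul_mul_assoc, map_add, map_add, ptEval_tr_csmul,
    ptEval_tr_csmul, hu', hv', star_add, star_mul', star_mul', star_neg, Complex.star_def,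
    Complex.conj_I] at f2
  rw [Complex.star_def] at f1 ⊢
  refine mul_left_cancel₀ (mul_ne_zero two_ne_zero Complex.I_ne_zero) ?_
  linear_combination -Complex.I * f1 - f2

/-- It is enough to check the reality of a derivation on Hermitian elements. -/
theorem isRealDer_of_hermitian {D : Der 𝒜} (h : ∀ a, IsAdj a a → IsAdj (D.1 a) (D.1 a)) :
    IsRealDer D := by
  intro a b hab
  have k3 := ((h _ hab.add_self).const_smul (1 / 2)).add
    ((h _ hab.I_smul_add_self).const_smul (-Complex.I / 2))
  have c0 : star (1 / 2 : ℂ) = 1 / 2 := by simp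
  have c3 : star (-Complex.I / 2) = Complex.I / 2 := by simp
  have c1 : Complex.I / 2 * Complex.I = -(1 / 2) := by linear_combination (1 / 2) * Complex.I_sq
  have h2 : (1 / 2 + 1 / 2 : ℂ) = 1 := by norm_num
  have e1 : ∀ u v : 𝒜, (1 / 2 : ℂ) • (u + v) + (-Complex.I / 2) •
      (Complex.I • u + (-Complex.I) • v) = u := by
    intro u v
    rw [smul_add, smul_add, smul_smul, smul_smul, mul_neg, neg_div, neg_mul, c1, neg_neg,
      neg_smul, add_add_add_comm, ← add_smul, add_neg_cancel, add_zero, h2, one_smul]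
  have e2 : ∀ u v : 𝒜, (1 / 2 : ℂ) • (u + v) + (Complex.I / 2) •
      (Complex.I • u + (-Complex.I) • v) = v := by
    intro u v
    rw [smul_add, smul_add, smul_smul, smul_smul, mul_neg, c1, neg_neg,
      neg_smul, add_add_add_comm, ← add_smul, add_neg_cancel, zero_add, h2, one_smul]
  rw [c0, c3, D.1.map_add, D.1.map_add, D.1.map_smul, D.1.map_smul, e1, e2] at k3
  exact k3

/-- For a real metric, the horizontal lift of a real vector field is a real derivation. -/
theorem IsHorizontalLift.isRealDer {h : DerBimoduleForm d n E} (hr : h.IsReal)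
    (hM : (baseMetric h).IsNondegenerate) {X : VF 𝒜} (hX : IsRealField X) {D : Der 𝒜}
    (hD : IsHorizontalLift h X D) : IsRealDer D :=
  isRealDer_of_hermitian fun _ ha => isAdj_of_conjC_tr fun _ hc => hD.conjC_tr hr hM hX hc ha

/-! ### Hermitian connections -/

/-- In a local unitary frame, the traceless endomorphism `γ` attached to a real derivation is
skew-Hermitian. -/
theorem LocalFrame.star_entry_gam {F : LocalFrame d n E} {x : M} (hx : x ∈ F.V) {D : Der 𝒜}
    (hD : IsRealDer D) (i k : Fin n) :
    star (ptEval d n E x (F.entry i k (F.gam D))) + ptEval d n E x (F.entry k i (F.gam D)) = 0 := by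
  set γ : Fin n → Fin n → ℂ := fun i k => ptEval d n E x (F.entry i k (F.gam D)) with hγ
  have hent : ∀ k l i m, ptEval d n E x (F.entry i m (D.1 (F.unit k l))) =
      (if l = m then γ i k else 0) - if i = k then γ l m else 0 := by
    intro k l i m
    simp only [hγ, ptEval_entry hx]
    rw [der_unit_val hx, LinearMap.sub_apply, Module.End.mul_apply, Module.End.mul_apply, map_sub,
      Finsupp.sub_apply, F.unit_val x hx, F.unit_val x hx, map_smul, map_smul, map_smul,
      Finsupp.smul_apply, Finsupp.smul_apply, Module.Basis.repr_self, Module.Basis.repr_self,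
      Finsupp.single_apply, Finsupp.single_apply, smul_eq_mul, smul_eq_mul, ite_mul, one_mul,
      zero_mul, mul_ite, mul_one, mul_zero]
    simp only [eq_comm]
  have hadj : ∀ k l i m, ptEval d n E x (F.entry m i (D.1 (F.unit l k))) =
      star (ptEval d n E x (F.entry i m (D.1 (F.unit k l)))) := by
    intro k l i m
    obtain ⟨u, v, huv, hu, hv⟩ := F.exists_isAdj_unit hx k l
    have h1 := (hD u v huv).entry hx m i
    simp only [ptEval_entry hx] at h1 ⊢
    rwa [der_congr D hu, der_congr D hv] at h1
  -- As `D` is real, `[γ + γ^*, e_kl] = 0` for all `k, l`, so `γ + γ^*` is a multiple of the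
  -- identity.
  have hg : ∀ i k l, star (γ i k) + γ k i = if i = k then star (γ l l) + γ l l else 0 := by
    intro i k l
    have h1 := hadj k l i l
    rw [hent, hent] at h1
    by_cases hik : i = k
    · subst hik
      simp only [if_true, star_sub] at h1 ⊢
      linear_combination -h1
    · simp only [hik, Ne.symm hik, if_true, if_false, star_sub, star_zero] at h1 ⊢
      linear_combination -h1
  have htr : ∑ i, γ i i = 0 := by
    have h1 := trace_gam hx D
    rw [LinearMap.trace_eq_matrix_trace ℂ (F.basis x hx), Matrix.trace] at h1
    simp only [Matrix.diag_apply, LinearMap.toMatrix_apply, ← ptEval_entry hx] at h1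
    exact h1
  -- The multiple is zero since `γ` is traceless.
  have hdiag : ∀ l, star (γ l l) + γ l l = 0 := by
    intro l
    have h1 : ∑ i : Fin n, (star (γ i i) + γ i i) = 0 := by
      rw [Finset.sum_add_distrib, ← star_sum, htr, star_zero, add_zero]
    have h2 : ∀ i, star (γ i i) + γ i i = star (γ l l) + γ l l := fun i => by
      rw [hg i i l, if_pos rfl]
    simp only [h2, Finset.sum_const, Finset.card_univ, Fintype.card_fin, nsmul_eq_mul] at h1
    exact (mul_eq_zero.mp h1).resolve_left (Nat.cast_ne_zero.mpr (NeZero.ne n))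
  have h1 := hg i k i
  rw [hdiag, ite_self] at h1
  exact h1

/-- A connection preserving the volume form is Hermitian if it induces real derivations of
`Γ(End 𝓔)`. -/
theorem Connection.IsInducedOnEnd.isHermitian_of_isRealDer {D : Connection d n E}
    {nab : VF 𝒜 →ₗ[𝒵] Der 𝒜} (hD : D.IsInducedOnEnd nab) (hv : D.PreservesVolume)
    (hr : ∀ X, IsRealField X → IsRealDer (nab X)) : D.IsHermitian := by
  intro X hX s t
  refine center_ext fun x => ?_
  obtain ⟨F, hx⟩ := exists_localFrame (d := d) (n := n) (E := E) x
  -- Differentiate the expression of the Hermitian product in a unitary frame.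
  have h1 : NCG.ptEval d n E x (X (herm s t)) =
      NCG.ptEval d n E x (X (∑ i, conjC (F.coord i s) * F.coord i t)) := by
    refine vf_congr _ ?_
    filter_upwards [F.isOpen.mem_nhds hx] with y hy
    rw [ptEval_herm, F.hermFun_val y hy, map_sum]
    simp only [map_mul, ptEval_conjC, F.ptEval_coord y hy]
  have hγ : ∑ i, (star ((F.basis x hx).repr ((F.gam (nab X)).val x (s.1 x)) i) *
        (F.basis x hx).repr (t.1 x) i +
      star ((F.basis x hx).repr (s.1 x) i) *
        (F.basis x hx).repr ((F.gam (nab X)).val x (t.1 x)) i) = 0 := by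
    rw [Finset.sum_add_distrib]
    simp only [LocalFrame.repr_val hx, star_sum, star_mul', Finset.sum_mul, Finset.mul_sum]
    rw [Finset.sum_comm, ← Finset.sum_add_distrib]
    refine Finset.sum_eq_zero fun i _ => ?_
    rw [← Finset.sum_add_distrib]
    refine Finset.sum_eq_zero fun j _ => ?_
    linear_combination (star ((F.basis x hx).repr (s.1 x) i) * (F.basis x hx).repr (t.1 x) j) *
      LocalFrame.star_entry_gam hx (hr X hX) j i
  rw [h1, map_add, ptEval_herm, ptEval_herm, F.hermFun_val x hx, F.hermFun_val x hx,
    ← Finset.sum_add_distrib, val_eq_localConn hv hD F hx, val_eq_localConn hv hD F hx]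
  simp only [LocalFrame.repr_localConn hx, hD.rho_nab, map_sum, Derivation.leibniz, map_add,
    smul_eq_mul, map_mul, ptEval_conjC, hX.conjC_apply, F.ptEval_coord x hx]
  rw [← sub_eq_zero, ← Finset.sum_sub_distrib, ← neg_eq_zero, ← Finset.sum_neg_distrib, ← hγ]
  refine Finset.sum_congr rfl fun i _ => ?_
  rw [star_add]
  ring

end

end NCG

theorem mainTheorem2 {d n : ℕ} [NeZero n] {M : Type*} [TopologicalSpace M]
    [ChartedSpace (EuclideanSpace ℝ (Fin d)) M] [IsManifold (𝓡 d) ∞ M] [T2Space M]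
    [ParacompactSpace M]
    (E : M → Type*) [∀ x, AddCommGroup (E x)] [∀ x, Module ℂ (E x)] [∀ x, TopologicalSpace (E x)]
    [TopologicalSpace (TotalSpace (NCG.Fib n) E)] [FiberBundle (NCG.Fib n) E]
    [VectorBundle ℂ (NCG.Fib n) E] [NCG.IsSUBundle d n E]
    (h : NCG.DerBimoduleForm d n E) (hh : h.IsMetric)
    (hM : (h.push NCG.rho).restrictCenter.IsNondegenerate) :
    (∃! D : NCG.Connection d n E, D.PreservesVolume ∧
      ∃ (nab : NCG.VF (NCG.EndSec d n E) →ₗ[NCG.Ctr (NCG.EndSec d n E)] NCG.Der (NCG.EndSec d n E))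
        (α : NCG.Der (NCG.EndSec d n E) →ₗ[NCG.Ctr (NCG.EndSec d n E)] NCG.Traceless d n E),
        D.IsInducedOnEnd nab ∧ NCG.IsConnectionForm nab α ∧ NCG.IsOrthogonal h α) ∧
    ∀ (D : NCG.Connection d n E)
      (nab : NCG.VF (NCG.EndSec d n E) →ₗ[NCG.Ctr (NCG.EndSec d n E)] NCG.Der (NCG.EndSec d n E))
      (α : NCG.Der (NCG.EndSec d n E) →ₗ[NCG.Ctr (NCG.EndSec d n E)] NCG.Traceless d n E),
      D.PreservesVolume → D.IsInducedOnEnd nab → NCG.IsConnectionForm nab α →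
      NCG.IsOrthogonal h α →
        (∀ θ η, h.toFun θ η = ((h.push NCG.rho).push nab).toFun θ η +
          ((h.push α).push (NCG.adTraceless d n E)).toFun θ η) ∧
        (h.push NCG.rho).IsMetric ∧ (h.push α).IsMetric ∧ (h.IsReal → D.IsHermitian) := by
  obtain ⟨nab₀, hnab₀⟩ :=
    NCG.exists_linear_horizontalLift hM (NCG.exists_isHorizontalLift hh.2 hM)
  constructor
  · have hn : ∀ X, NCG.rho (nab₀ X) = X := fun X => (hnab₀ X).rho_eq
    obtain ⟨D, hv, hD⟩ := NCG.exists_connection hn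
    obtain ⟨α, hα⟩ := NCG.exists_isConnectionForm hn
    refine ⟨D, ⟨hv, nab₀, α, hD, hα, NCG.isOrthogonal_of_isHorizontalLift hh.2 hM hnab₀ hα⟩, ?_⟩
    rintro D' ⟨hv', nab, α', hD', hα', ho⟩
    have hnab : nab = nab₀ := LinearMap.ext fun X => ho.eq_of_isHorizontalLift hα' (hnab₀ X)
    subst hnab
    exact NCG.Connection.eq_of_isInducedOnEnd hv' hv hD' hD
  · intro D nab α hv hD hα ho
    obtain ⟨h1, h2, h3⟩ := ho.metric_splitting hh hα hD.rho_nab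
    refine ⟨h1, h2, h3, fun hr => hD.isHermitian_of_isRealDer hv fun X hX => ?_⟩
    rw [ho.eq_of_isHorizontalLift hα (hnab₀ X)]
    exact (hnab₀ X).isRealDer hr hM hX
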